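/- Let $A$ be a (finite dimensional) $C^*$-weak Hopf algebra, i.e. a finite dimensional $C^*$-algebra over $\mathbb C$ with a coassociative counital coalgebra structure $(\Delta,\varepsilon)$ and a linear map $S\colon A\to A$ (the antipode) such that, in Sweedler notation and for all $x,y,z\in A$, $$\Delta(xy)=\Delta(x)\Delta(y),\qquad \Delta(x^*)=\Delta(x)^*,$$ $$\varepsilon(xyz)=\varepsilon(xy_{(1)})\varepsilon(y_{(2)}z)=\varepsilon(xy_{(2)})\varepsilon(y_{(1)}z),$$ $$(\Delta\otimes\mathrm{id})\Delta(1)=(\Delta(1)\otimes 1)(1\otimes\Delta(1))=(1\otimes\Delta(1))(\Delta(1)\otimes 1),$$ $$x_{(1)}S(x_{(2)})=\Pi^L(x):=\varepsilon(1_{(1)}x)1_{(2)},\quad S(x_{(1)})x_{(2)}=\Pi^R(x):=1_{(1)}\varepsilon(x1_{(2)}),\quad S(x_{(1)})x_{(2)}S(x_{(3)})=S(x).$$ A Haar integral of a weak Hopf algebra is an element $h$ with $xh=\Pi^L(x)h$ and $hx=h\Pi^R(x)$ for all $x$, and $\Pi^L(h)=\Pi^R(h)=1$. Let $\hat A$ be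 the dual weak Hopf algebra of $A$, that is, the space of linear functionals on $A$ with product $(\varphi\psi)(x)=\varphi(x_{(1)})\psi(x_{(2)})$, unit $\varepsilon$, coproduct $\hat\Delta(\varphi)(x\otimes y)=\varphi(xy)$ and counit $\hat\varepsilon(\varphi)=\varphi(1)$. Then $A$ has a unique Haar integral $h$, and $\hat A$ has a unique Haar integral $\hat h$ (the Haar functional on $A$). The element $h\leftharpoonup\hat h:=\hat h(h_{(1)})h_{(2)}$ of $A$ is positive and invertible, and with $g_R:=(h\leftharpoonup\hat h)^{1/2}$ the following conditions are equivalent: 1. $S^2=\mathrm{id}_A$ (that is, $A$ is a weak Kac algebra); 2. $\hat h$ is a trace on $A$, i.e. $\hat h(xy)=\hat h(yx)$ for all $x,y\in A$; 3. $\varepsilon(g_R^{-2})=\dim_{\mathbb C}A$. -/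

import Mathlib

open scoped TensorProduct

noncomputable section

/-- The linear map `a ⊗ b ↦ φ a • b`. -/
def applyFst {k A : Type*} [Field k] [Ring A] [Algebra k A] (φ : Module.Dual k A) :
    A ⊗[k] A →ₗ[k] A :=
  TensorProduct.lift ((LinearMap.lsmul k A).comp φ)

/-- The linear map `a ⊗ b ↦ φ b • a`. -/
def applySnd {k A : Type*} [Field k] [Ring A] [Algebra k A] (φ : Module.Dual k A) :
    A ⊗[k] A →ₗ[k] A :=
  TensorProduct.lift ((LinearMap.lsmul k A).comp φ).flip

/-- The linear form `a ⊗ b ↦ φ a * ψ b`. -/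
def dualTensor {k A : Type*} [Field k] [Ring A] [Algebra k A] (φ ψ : Module.Dual k A) :
    Module.Dual k (A ⊗[k] A) :=
  (LinearMap.mul' k k).comp (TensorProduct.map φ ψ)

/-- A weak Hopf algebra over a field `k` (Böhm–Nill–Szlachányi). In Sweedler notation:
* `Δ(xy) = Δ(x)Δ(y)`;
* `ε(xyz) = ε(x y₍₁₎) ε(y₍₂₎ z) = ε(x y₍₂₎) ε(y₍₁₎ z)`;
* `(Δ ⊗ id)Δ(1) = (Δ(1) ⊗ 1)(1 ⊗ Δ(1)) = (1 ⊗ Δ(1))(Δ(1) ⊗ 1)`;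
* `x₍₁₎ S(x₍₂₎) = ε(1₍₁₎ x) 1₍₂₎`, `S(x₍₁₎) x₍₂₎ = 1₍₁₎ ε(x 1₍₂₎)`,
  `S(x₍₁₎) x₍₂₎ S(x₍₃₎) = S(x)`.
Neither `Δ(1) = 1 ⊗ 1` nor multiplicativity of `ε` is required. -/
class WeakHopfAlgebra (k A : Type*) [Field k] [Ring A] [Algebra k A] extends
    Coalgebra k A where
  comul_mul (x y : A) : comul (x * y) = comul x * comul y
  counit_mul_mul (x y z : A) : counit (x * y * z) =
    dualTensor (counit.comp (LinearMap.mulLeft k x)) (counit.comp (LinearMap.mulRight k z))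
      (comul y)
  counit_mul_mul' (x y z : A) : counit (x * y * z) =
    dualTensor (counit.comp (LinearMap.mulRight k z)) (counit.comp (LinearMap.mulLeft k x))
      (comul y)
  comul_comul_one : TensorProduct.map comul LinearMap.id (comul 1) =
    (comul 1 ⊗ₜ[k] 1) * (TensorProduct.assoc k A A A).symm (1 ⊗ₜ[k] comul 1)
  comul_comul_one' : TensorProduct.map comul LinearMap.id (comul 1) =
    (TensorProduct.assoc k A A A).symm (1 ⊗ₜ[k] comul 1) * (comul 1 ⊗ₜ[k] 1)
  /-- The antipode `S`. -/
  antipode : A →ₗ[k] A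
  mul_antipode (x : A) : LinearMap.mul' k A (TensorProduct.map LinearMap.id antipode (comul x)) =
    applyFst (counit.comp (LinearMap.mulRight k x)) (comul 1)
  antipode_mul (x : A) : LinearMap.mul' k A (TensorProduct.map antipode LinearMap.id (comul x)) =
    applySnd (counit.comp (LinearMap.mulLeft k x)) (comul 1)
  antipode_mul_antipode (x : A) :
    LinearMap.mul' k A (TensorProduct.map
      ((LinearMap.mul' k A).comp (TensorProduct.map antipode LinearMap.id)) antipode
      (TensorProduct.map comul LinearMap.id (comul x))) = antipode x

/-- A (finite dimensional) C⋆-algebra with a weak Hopf algebra structure whose coproduct is a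
⋆-homomorphism, `Δ(x⋆) = Δ(x)⋆` with `(a ⊗ b)⋆ = a⋆ ⊗ b⋆`. Finite dimensionality is a separate
hypothesis `[FiniteDimensional ℂ A]`. -/
class CStarWeakHopfAlgebra (A : Type*) [CStarAlgebra A] extends WeakHopfAlgebra ℂ A where
  comul_star (x : A) : comul (star x) = star (comul x)

namespace WeakHopfAlgebra

open Coalgebra

variable {k A : Type*} [Field k] [Ring A] [Algebra k A] [WeakHopfAlgebra k A]

variable (k) in
/-- `Π^L(x) = ε(1₍₁₎ x) 1₍₂₎`. -/
def piL (x : A) : A :=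
  applyFst (counit.comp (LinearMap.mulRight k x)) (comul (R := k) 1)

variable (k) in
/-- `Π^R(x) = 1₍₁₎ ε(x 1₍₂₎)`. -/
def piR (x : A) : A :=
  applySnd (counit.comp (LinearMap.mulLeft k x)) (comul (R := k) 1)

variable (k) in
/-- A Haar integral of `A`: a two-sided integral (`x h = Π^L(x) h` and `h x = h Π^R(x)` for all
`x`) which is normalized (`Π^L(h) = 1 = Π^R(h)`). -/
structure IsHaarIntegral (h : A) : Prop where
  left_integral : ∀ x : A, x * h = piL k x * h
  right_integral : ∀ x : A, h * x = h * piR k x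
  left_normalized : piL k h = 1
  right_normalized : piR k h = 1

/-! The operations of the dual weak Hopf algebra `Â = Hom(A, k)`: its product is
`(φψ)(x) = φ(x₍₁₎) ψ(x₍₂₎)`, its unit is `1̂ = ε`, its coproduct is `Δ̂(φ)(x ⊗ y) = φ(xy)` and
its counit is `ε̂(φ) = φ(1)`. -/

/-- The product of `Â`. -/
def dualMul (φ ψ : Module.Dual k A) : Module.Dual k A :=
  (dualTensor φ ψ).comp comul

/-- `Π̂^L(φ) = ε̂(1̂₍₁₎ φ) 1̂₍₂₎` in `Â`. Since `1̂₍₁₎(y) 1̂₍₂₎(x) = ε(yx)`, its value at `x` is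
the value at `1` of the product of `ε(· x)` and `φ`. -/
def dualPiL (φ : Module.Dual k A) : Module.Dual k A where
  toFun x := dualMul (counit.comp (LinearMap.mulRight k x)) φ 1
  map_add' x y := by
    have e : LinearMap.mulRight k (x + y) = LinearMap.mulRight k x + LinearMap.mulRight k y := by
      ext z; simp [mul_add]
    simp [dualMul, dualTensor, e, LinearMap.comp_add, TensorProduct.map_add_left]
  map_smul' c x := by
    have e : LinearMap.mulRight k (c • x) = c • LinearMap.mulRight k x := by
      ext z; simp
    simp [dualMul, dualTensor, e, LinearMap.comp_smul, TensorProduct.map_smul_left]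

/-- `Π̂^R(φ) = 1̂₍₁₎ ε̂(φ 1̂₍₂₎)` in `Â`. Since `1̂₍₁₎(x) 1̂₍₂₎(y) = ε(xy)`, its value at `x` is
the value at `1` of the product of `φ` and `ε(x ·)`. -/
def dualPiR (φ : Module.Dual k A) : Module.Dual k A where
  toFun x := dualMul φ (counit.comp (LinearMap.mulLeft k x)) 1
  map_add' x y := by
    have e : LinearMap.mulLeft k (x + y) = LinearMap.mulLeft k x + LinearMap.mulLeft k y := by
      ext z; simp [add_mul]
    simp [dualMul, dualTensor, e, LinearMap.comp_add, TensorProduct.map_add_right]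
  map_smul' c x := by
    have e : LinearMap.mulLeft k (c • x) = c • LinearMap.mulLeft k x := by
      ext z; simp
    simp [dualMul, dualTensor, e, LinearMap.comp_smul, TensorProduct.map_smul_right]

/-- A Haar functional on `A`: a Haar integral of the dual weak Hopf algebra `Â`, i.e. a normalized
two-sided integral of `Â`, regarded as a linear functional on `A`. -/
structure IsHaarFunctional (η : Module.Dual k A) : Prop where
  left_integral : ∀ φ : Module.Dual k A, dualMul φ η = dualMul (dualPiL φ) η
  right_integral : ∀ φ : Module.Dual k A, dualMul η φ = dualMul η (dualPiR φ)
  left_normalized : dualPiL η = counit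
  right_normalized : dualPiR η = counit

/-- The right action `x ↼ φ = φ(x₍₁₎) x₍₂₎` of `Â` on `A`. -/
def hitRight (x : A) (φ : Module.Dual k A) : A :=
  applyFst φ (comul x)

end WeakHopfAlgebra

/-- The element `g_R = (h ↼ ĥ)^{1/2}` built from the Haar integral `h` and the Haar functional
`ĥ`; it is the `A^R`-factor of the canonical grouplike element `g = g_L g_R⁻¹`, where
`g_L = (ĥ ⇀ h)^{1/2}`. -/
def grouplikeR {A : Type*} [CStarAlgebra A] [PartialOrder A] [StarOrderedRing A]
    [CStarWeakHopfAlgebra A] (h : A) (η : Module.Dual ℂ A) : A :=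
  CFC.sqrt (WeakHopfAlgebra.hitRight h η)

end

/-!
Let `h` be the Haar integral; it is the projection `1 - q`, where the projection `q` generates the
largest left ideal contained in the kernel of `ε`. Then `S(h₍₁₎) ⊗ h₍₂₎` is a separability
idempotent, and contracting it with the regular trace `tr` gives an element `d` with
`x d = d S²(x)`. It is positive and invertible, and `λ = tr(d⁻¹ ·)` is a dual basis functional for
`h`, which forces the strong invariance `λ(x₍₂₎ S(u)) x₍₁₎ = λ(x S(u₍₁₎)) u₍₂₎`. The restriction of
`ε` to `A^R` has a density `z` with respect to `λ`, the Haar functional is `ĥ = λ(· z)`, and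
`h ↼ ĥ = z`. Positivity of `z` comes from `λ(y⋆ z y) = λ((h y)⋆ (h y))` for `y ∈ A^R`.

If `S² = id` then the separability idempotent is symmetric, so `d = 1`; conversely `d = 1` gives
`S² = id` at once. As `tr d = tr 1 = dim A` and `d + d⁻¹ - 2 = (d - 1) d⁻¹ (d - 1) ≥ 0`, the
equality `d = 1` amounts to `tr(d⁻¹) = dim A`, and `ε(g_R⁻²) = ε(z⁻¹) = λ(1) = tr(d⁻¹)`. The trace
property of `ĥ` is read off from `d = 1` and the centrality of `z` in one direction, and in the
other from applying `ĥ(u₍₁₎ v) u₍₂₎ = S(ĥ(u v₍₁₎) v₍₂₎)` twice.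
-/

noncomputable section

open Coalgebra TensorProduct Ring

/-! ### Contractions and convolution -/

section Contraction

variable {k A : Type*} [Field k] [Ring A] [Algebra k A]

@[simp] theorem applyFst_tmul (φ : Module.Dual k A) (a b : A) :
    applyFst φ (a ⊗ₜ[k] b) = φ a • b := by simp [applyFst]

@[simp] theorem applySnd_tmul (φ : Module.Dual k A) (a b : A) :
    applySnd φ (a ⊗ₜ[k] b) = φ b • a := by simp [applySnd]

@[simp] theorem dualTensor_tmul (φ ψ : Module.Dual k A) (a b : A) :
    dualTensor φ ψ (a ⊗ₜ[k] b) = φ a * ψ b := by simp [dualTensor]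

theorem apply_applyFst (φ ψ : Module.Dual k A) (t : A ⊗[k] A) :
    ψ (applyFst φ t) = dualTensor φ ψ t := by
  induction t <;> simp_all

theorem apply_applySnd (φ ψ : Module.Dual k A) (t : A ⊗[k] A) :
    ψ (applySnd φ t) = dualTensor ψ φ t := by
  induction t <;> simp_all [mul_comm]

theorem applyFst_map (φ : Module.Dual k A) (f g : A →ₗ[k] A) (t : A ⊗[k] A) :
    applyFst φ (TensorProduct.map f g t) = g (applyFst (φ ∘ₗ f) t) := by
  induction t <;> simp_all

theorem applySnd_map (φ : Module.Dual k A) (f g : A →ₗ[k] A) (t : A ⊗[k] A) :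
    applySnd φ (TensorProduct.map f g t) = f (applySnd (φ ∘ₗ g) t) := by
  induction t <;> simp_all

theorem applyFst_mul_one_tmul (φ : Module.Dual k A) (t : A ⊗[k] A) (y : A) :
    applyFst φ (t * (1 ⊗ₜ y)) = applyFst φ t * y := by
  induction t <;> simp_all [add_mul]

theorem applyFst_one_tmul_mul (φ : Module.Dual k A) (t : A ⊗[k] A) (y : A) :
    applyFst φ ((1 ⊗ₜ y) * t) = y * applyFst φ t := by
  induction t <;> simp_all [mul_add]

theorem applyFst_mul_tmul_one (φ : Module.Dual k A) (t : A ⊗[k] A) (y : A) :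
    applyFst φ (t * (y ⊗ₜ 1)) = applyFst (φ ∘ₗ LinearMap.mulRight k y) t := by
  induction t <;> simp_all [add_mul]

theorem applyFst_tmul_one_mul (φ : Module.Dual k A) (t : A ⊗[k] A) (y : A) :
    applyFst φ ((y ⊗ₜ 1) * t) = applyFst (φ ∘ₗ LinearMap.mulLeft k y) t := by
  induction t <;> simp_all [mul_add]

theorem applySnd_mul_tmul_one (φ : Module.Dual k A) (t : A ⊗[k] A) (y : A) :
    applySnd φ (t * (y ⊗ₜ 1)) = applySnd φ t * y := by
  induction t <;> simp_all [add_mul]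

theorem applySnd_tmul_one_mul (φ : Module.Dual k A) (t : A ⊗[k] A) (y : A) :
    applySnd φ ((y ⊗ₜ 1) * t) = y * applySnd φ t := by
  induction t <;> simp_all [mul_add]

theorem applySnd_mul_one_tmul (φ : Module.Dual k A) (t : A ⊗[k] A) (y : A) :
    applySnd φ (t * (1 ⊗ₜ y)) = applySnd (φ ∘ₗ LinearMap.mulRight k y) t := by
  induction t <;> simp_all [add_mul]

theorem applySnd_one_tmul_mul (φ : Module.Dual k A) (t : A ⊗[k] A) (y : A) :
    applySnd φ ((1 ⊗ₜ y) * t) = applySnd (φ ∘ₗ LinearMap.mulLeft k y) t := by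
  induction t <;> simp_all [mul_add]

theorem lid_rTensor (φ : Module.Dual k A) (t : A ⊗[k] A) :
    TensorProduct.lid k A (φ.rTensor A t) = applyFst φ t := by
  induction t <;> simp_all

theorem rid_lTensor (φ : Module.Dual k A) (t : A ⊗[k] A) :
    TensorProduct.rid k A (φ.lTensor A t) = applySnd φ t := by
  induction t <;> simp_all

theorem applyFst_comm (φ : Module.Dual k A) (t : A ⊗[k] A) :
    applyFst φ (TensorProduct.comm k A A t) = applySnd φ t := by
  induction t <;> simp_all

theorem applySnd_comm (φ : Module.Dual k A) (t : A ⊗[k] A) :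
    applySnd φ (TensorProduct.comm k A A t) = applyFst φ t := by
  induction t <;> simp_all

theorem ext_applyFst {s t : A ⊗[k] A} (h : ∀ φ : Module.Dual k A, applyFst φ s = applyFst φ t) :
    s = t := by
  classical
  apply (TensorProduct.equivFinsuppOfBasisLeft (Module.Basis.ofVectorSpace k A)).injective
  refine Finsupp.ext fun i => ?_
  simp only [TensorProduct.equivFinsuppOfBasisLeft_apply, lid_rTensor, h]

theorem ext_applySnd {s t : A ⊗[k] A} (h : ∀ φ : Module.Dual k A, applySnd φ s = applySnd φ t) :
    s = t :=
  (TensorProduct.comm k A A).injective <| ext_applyFst fun φ => by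
    rw [applyFst_comm, applyFst_comm, h]

theorem map_applyFst_assoc_symm_tmul (φ : Module.Dual k A) (a : A) (s : A ⊗[k] A) :
    TensorProduct.map (applyFst φ) LinearMap.id ((TensorProduct.assoc k A A A).symm (a ⊗ₜ s)) =
      φ a • s := by
  induction s <;> simp_all [tmul_add, smul_tmul']

theorem map_applySnd_assoc_tmul (φ : Module.Dual k A) (s : A ⊗[k] A) (c : A) :
    TensorProduct.map LinearMap.id (applySnd φ) (TensorProduct.assoc k A A A (s ⊗ₜ c)) =
      φ c • s := by
  induction s <;> simp_all [add_tmul]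

end Contraction

section Convolution

variable {k C B B' : Type*} [CommSemiring k] [AddCommMonoid C] [Module k C] [Coalgebra k C]
  [Semiring B] [Algebra k B] [Semiring B'] [Algebra k B']

theorem mul'_mul_one_tmul (s : B ⊗[k] B) (x : B) :
    LinearMap.mul' k B (s * (1 ⊗ₜ x)) = LinearMap.mul' k B s * x := by
  induction s <;> simp_all [add_mul, mul_assoc]

/-- The convolution product of two linear maps from a coalgebra to an algebra, that is, Mathlib's
product on `WithConv (C →ₗ[k] B)` read on the linear maps themselves. -/
def convMul (f g : C →ₗ[k] B) : C →ₗ[k] B :=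
  (WithConv.toConv f * WithConv.toConv g).ofConv

local infixl:70 " ⋆ " => convMul

theorem convMul_apply (f g : C →ₗ[k] B) (x : C) :
    (f ⋆ g) x = LinearMap.mul' k B (TensorProduct.map f g (comul x)) := rfl

theorem convMul_repr (f g : C →ₗ[k] B) {x : C} {ι : Type*} (r : Coalgebra.Repr k x ι) :
    (f ⋆ g) x = ∑ i ∈ r.index, f (r.left i) * g (r.right i) := by
  simp [convMul_apply, ← r.eq]

theorem convMul_assoc (f g h : C →ₗ[k] B) : f ⋆ g ⋆ h = f ⋆ (g ⋆ h) :=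
  congrArg WithConv.ofConv
    (mul_assoc (WithConv.toConv f) (WithConv.toConv g) (WithConv.toConv h))

theorem mulLeft_comp_convMul (c : B) (f g : C →ₗ[k] B) :
    (LinearMap.mulLeft k c ∘ₗ f) ⋆ g = LinearMap.mulLeft k c ∘ₗ (f ⋆ g) := by
  ext x
  simp [convMul_repr _ _ (ℛ k x), mul_assoc]

theorem algHom_comp_convMul (φ : B →ₐ[k] B') (f g : C →ₗ[k] B) :
    φ.toLinearMap ∘ₗ (f ⋆ g) = (φ.toLinearMap ∘ₗ f) ⋆ (φ.toLinearMap ∘ₗ g) := by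
  ext x
  simp [convMul_repr _ _ (ℛ k x)]

theorem eq_of_convMul_convMul_eq {f g g' : C →ₗ[k] B} (hg : g ⋆ f ⋆ g = g)
    (hf : f ⋆ g = f ⋆ g') (hg' : g ⋆ f ⋆ g' = g') : g = g' := by
  rw [← hg, convMul_assoc, hf, ← convMul_assoc, hg']

end Convolution

/-! ### The regular trace -/

section RegularTrace

variable {k A : Type*} [CommRing k] [Ring A] [Algebra k A]

variable (k A) in
/-- The regular trace of an algebra: the trace of left multiplication, as a linear functional. It
plays the role of the faithful trace from which the Haar functional is built. -/
def regularTrace : Module.Dual k A :=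
  LinearMap.trace k A ∘ₗ (Algebra.lmul k A).toLinearMap

theorem regularTrace_apply (a : A) :
    regularTrace k A a = LinearMap.trace k A (LinearMap.mulLeft k a) := rfl

theorem regularTrace_one [Module.Free k A] [Module.Finite k A] :
    regularTrace k A 1 = Module.finrank k A := by
  rw [regularTrace_apply, LinearMap.mulLeft_one]
  exact LinearMap.trace_id k A

theorem regularTrace_mul_comm (a b : A) :
    regularTrace k A (a * b) = regularTrace k A (b * a) := by
  simp only [regularTrace_apply, LinearMap.mulLeft_mul]
  exact LinearMap.trace_mul_comm k _ _

end RegularTrace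

section FiniteDimensional

variable {k A : Type*} [Field k] [Ring A] [Algebra k A]

variable (k) in
theorem isUnit_of_forall_mul_eq_zero [FiniteDimensional k A] {a : A}
    (ha : ∀ x, a * x = 0 → x = 0) : IsUnit a :=
  (Algebra.lmul_isUnit_iff (R := k)).1 <|
    (LinearMap.isUnit_iff_ker_eq_bot (Algebra.lmul k A a)).2 (LinearMap.ker_eq_bot'.2 ha)

theorem exists_eq_comp_mulRight [FiniteDimensional k A] {f : Module.Dual k A}
    (hf : ∀ x, (∀ y, f (y * x) = 0) → x = 0) (φ : Module.Dual k A) :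
    ∃ x, φ = f ∘ₗ LinearMap.mulRight k x := by
  let T : A →ₗ[k] Module.Dual k A := (LinearMap.mul k A).flip.compr₂ f
  have T_injective : Function.Injective T :=
    (injective_iff_map_eq_zero T).2 fun x hx => hf x (LinearMap.congr_fun hx)
  obtain ⟨x, hx⟩ := (LinearMap.injective_iff_surjective_of_finrank_eq_finrank
    (Subspace.dual_finrank_eq (K := k) (V := A)).symm).1 T_injective φ
  exact ⟨x, hx.symm⟩

theorem spectrum_mulLeft (a : A) : spectrum k (LinearMap.mulLeft k a) = spectrum k a := by
  ext μ
  have mulLeft_eq : algebraMap k (Module.End k A) μ - LinearMap.mulLeft k a =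
      Algebra.lmul k A (algebraMap k A μ - a) := by
    rw [map_sub, AlgHom.commutes]; rfl
  rw [spectrum.mem_iff, spectrum.mem_iff, mulLeft_eq, Algebra.lmul_isUnit_iff]

theorem mem_roots_charpoly_mulLeft [FiniteDimensional k A] {a : A} {μ : k} :
    μ ∈ (LinearMap.mulLeft k a).charpoly.roots ↔ μ ∈ spectrum k a := by
  rw [← spectrum_mulLeft, ← Module.End.hasEigenvalue_iff_mem_spectrum,
    Module.End.hasEigenvalue_iff_isRoot_charpoly,
    Polynomial.mem_roots (LinearMap.charpoly_monic _).ne_zero]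

theorem regularTrace_eq_sum_roots [IsAlgClosed k] [FiniteDimensional k A] (a : A) :
    regularTrace k A a = (LinearMap.mulLeft k a).charpoly.roots.sum :=
  Module.End.trace_eq_sum_roots_charpoly_of_splits (IsAlgClosed.splits _)

end FiniteDimensional

/-! ### The regular trace of a finite dimensional C⋆-algebra -/

section InnerProductCore

variable {V : Type*} [AddCommGroup V] [Module ℂ V] [FiniteDimensional ℂ V]
  (c : InnerProductSpace.Core ℂ V)

theorem exists_mem_forall_core_inner_sub_eq_zero (N : Submodule ℂ V) (x : V) :
    ∃ p ∈ N, ∀ w ∈ N, c.inner w (x - p) = 0 := by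
  let := c.toNormedAddCommGroup
  let : InnerProductSpace ℂ V := InnerProductSpace.ofCore c.toCore
  exact ⟨N.starProjection x, N.starProjection_apply_mem x, fun w hw =>
    N.sub_starProjection_mem_orthogonal x w hw⟩

theorem exists_basis_core_inner_eq_ite : ∃ b : Module.Basis (Fin (Module.finrank ℂ V)) ℂ V,
    ∀ i j, c.inner (b i) (b j) = if i = j then 1 else 0 := by
  let := c.toNormedAddCommGroup
  let : InnerProductSpace ℂ V := InnerProductSpace.ofCore c.toCore
  refine ⟨(stdOrthonormalBasis ℂ V).toBasis, fun i j => ?_⟩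
  simpa using orthonormal_iff_ite.mp (stdOrthonormalBasis ℂ V).orthonormal i j

end InnerProductCore

section CStarAlgebra

open scoped ComplexOrder

variable {A : Type*} [CStarAlgebra A] [FiniteDimensional ℂ A] [PartialOrder A]
  [StarOrderedRing A]

theorem regularTrace_nonneg {a : A} (ha : 0 ≤ a) : 0 ≤ regularTrace ℂ A a := by
  rw [regularTrace_eq_sum_roots]
  exact Multiset.sum_nonneg fun μ hμ =>
    spectrum_nonneg_of_nonneg ha (mem_roots_charpoly_mulLeft.1 hμ)

theorem eq_zero_of_regularTrace_eq_zero {a : A} (ha : 0 ≤ a) (h : regularTrace ℂ A a = 0) :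
    a = 0 := by
  have normal : IsStarNormal a := (IsSelfAdjoint.of_nonneg ha).isStarNormal
  have roots_nonneg : ∀ μ ∈ (LinearMap.mulLeft ℂ a).charpoly.roots, 0 ≤ μ := fun μ hμ =>
    spectrum_nonneg_of_nonneg ha (mem_roots_charpoly_mulLeft.1 hμ)
  refine CFC.eq_zero_of_spectrum_subset_zero (R := ℂ) a fun μ hμ => ?_
  have root := mem_roots_charpoly_mulLeft.2 hμ
  have root_le := Multiset.single_le_sum roots_nonneg μ root
  rw [← regularTrace_eq_sum_roots, h] at root_le
  exact le_antisymm root_le (roots_nonneg μ root)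

theorem eq_zero_of_regularTrace_star_mul_self {x : A} (h : regularTrace ℂ A (star x * x) = 0) :
    x = 0 :=
  (CStarRing.star_mul_self_eq_zero_iff x).1
    (eq_zero_of_regularTrace_eq_zero (star_mul_self_nonneg x) h)

theorem regularTrace_nondegenerate (x : A) (h : ∀ y, regularTrace ℂ A (y * x) = 0) : x = 0 :=
  eq_zero_of_regularTrace_star_mul_self (h _)

theorem regularTrace_star (a : A) : regularTrace ℂ A (star a) = star (regularTrace ℂ A a) :=
  map_star (PositiveLinearMap.mk₀ (regularTrace ℂ A) fun _ => regularTrace_nonneg) a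

theorem regularTrace_mul_mul_star_nonneg {c : A} (hc : 0 ≤ c) (a : A) :
    0 ≤ regularTrace ℂ A (a * c * star a) :=
  regularTrace_nonneg (star_right_conjugate_nonneg hc a)

theorem eq_zero_of_regularTrace_mul_mul_star {a c : A} (hc : IsStrictlyPositive c)
    (h : regularTrace ℂ A (a * c * star a) = 0) : a = 0 := by
  obtain ⟨s, s_unit, s_selfAdjoint, rfl⟩ :=
    CStarAlgebra.isStrictlyPositive_iff_exists_isUnit_and_isSelfAdjoint_and_eq_mul_self.1 hc
  have mul_eq_zero : star (a * s) = 0 := eq_zero_of_regularTrace_star_mul_self <| by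
    rwa [star_star, star_mul, s_selfAdjoint.star_eq, mul_assoc, ← mul_assoc s, ← mul_assoc]
  exact s_unit.mul_left_eq_zero.1 (star_eq_zero.1 mul_eq_zero)

theorem eq_one_of_regularTrace_eq {d : A} (hd : IsStrictlyPositive d)
    (h : regularTrace ℂ A d = regularTrace ℂ A 1)
    (h_inv : regularTrace ℂ A d⁻¹ʳ = regularTrace ℂ A 1) : d = 1 := by
  have sandwich : (d - 1) * d⁻¹ʳ * star (d - 1) = d - 1 + (d⁻¹ʳ - 1) := by
    have self_inverse := Ring.mul_inverse_cancel d hd.isUnit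
    have inverse_self := Ring.inverse_mul_cancel d hd.isUnit
    rw [star_sub, star_one, hd.isSelfAdjoint.star_eq, sub_mul, self_inverse, one_mul, mul_sub,
      sub_mul, one_mul, inverse_self, mul_one]
    abel
  refine sub_eq_zero.1 (eq_zero_of_regularTrace_mul_mul_star hd.ringInverse ?_)
  rw [sandwich, map_add, map_sub, map_sub, h, h_inv, sub_self, add_zero]

variable (A) in
/-- The inner product `⟪x, y⟫ = tr (x⋆ y)` on a finite dimensional C⋆-algebra. -/
abbrev regularTraceCore : InnerProductSpace.Core ℂ A where
  inner x y := regularTrace ℂ A (star x * y)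
  conj_inner_symm x y := by
    change star (regularTrace ℂ A (star y * x)) = _
    rw [← regularTrace_star, star_mul, star_star]
  re_inner_nonneg x := (Complex.le_def.1 (regularTrace_nonneg (star_mul_self_nonneg x))).1
  add_left x y z := by rw [star_add, add_mul, map_add]
  smul_left x y r := by rw [star_smul, smul_mul_assoc, map_smul]; rfl
  definite _ := eq_zero_of_regularTrace_star_mul_self

theorem applyFst_regularTrace_star_mul_self_nonneg (t : A ⊗[ℂ] A) :
    0 ≤ applyFst (regularTrace ℂ A) (star t * t) := by
  obtain ⟨b, orthonormal⟩ := exists_basis_core_inner_eq_ite (regularTraceCore A)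
  replace orthonormal (i j) : regularTrace ℂ A (star (b i) * b j) = if i = j then 1 else 0 :=
    orthonormal i j
  obtain ⟨c, rfl⟩ := TensorProduct.eq_repr_basis_left b t
  rw [Finsupp.sum_fintype _ _ (by simp)]
  have applyFst_eq : applyFst (regularTrace ℂ A)
      (star (∑ i, b i ⊗ₜ[ℂ] c i) * ∑ i, b i ⊗ₜ[ℂ] c i) = ∑ i, star (c i) * c i := by
    simp [star_sum, Finset.sum_mul_sum, orthonormal]
  rw [applyFst_eq]
  exact Finset.sum_nonneg fun i _ => star_mul_self_nonneg _

theorem exists_isStarProjection_forall_mem_iff (N : Ideal A) :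
    ∃ q, IsStarProjection q ∧ ∀ x, x ∈ N ↔ x * q = x := by
  obtain ⟨q, q_mem, orthogonal⟩ := exists_mem_forall_core_inner_sub_eq_zero (regularTraceCore A)
    (N.restrictScalars ℂ) 1
  replace orthogonal : ∀ w ∈ N, regularTrace ℂ A (star w * (1 - q)) = 0 := orthogonal
  have mul_eq {x : A} (hx : x ∈ N) : x * q = x := by
    have x_mul_mem : x * (1 - q) ∈ N := by
      rw [mul_sub, mul_one]
      exact sub_mem hx (N.mul_mem_left x q_mem)
    have mul_eq_zero : x * (1 - q) = 0 := eq_zero_of_regularTrace_star_mul_self <| by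
      simpa only [star_mul, star_star, mul_assoc] using
        orthogonal _ (N.mul_mem_left (star x) x_mul_mem)
    rw [mul_sub, mul_one, sub_eq_zero] at mul_eq_zero
    exact mul_eq_zero.symm
  have star_eq : star q = q * star q := by
    have mul_star_eq_zero : (1 - q) * star q = 0 := regularTrace_nondegenerate _ fun a => by
      rw [← mul_assoc, regularTrace_mul_comm, ← mul_assoc]
      simpa only [star_mul, star_star] using orthogonal _ (N.mul_mem_left (star a) q_mem)
    rwa [sub_mul, one_mul, sub_eq_zero] at mul_star_eq_zero
  have selfAdjoint : IsSelfAdjoint q := by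
    rw [← IsSelfAdjoint.star_iff, star_eq]
    exact .mul_star_self q
  exact ⟨q, ⟨mul_eq q_mem, selfAdjoint⟩, fun x =>
    ⟨mul_eq, fun hx => hx ▸ N.mul_mem_left x q_mem⟩⟩

end CStarAlgebra

/-! ### Weak Hopf algebras -/

namespace WeakHopfAlgebra

variable {k A : Type*} [Field k] [Ring A] [Algebra k A] [WeakHopfAlgebra k A]

local infixl:70 " ⋆ " => convMul
local notation "S" => antipode (k := k) (A := A)

@[simp] theorem applyFst_counit_comul (x : A) : applyFst (counit (R := k)) (comul x) = x := by
  rw [← lid_rTensor, rTensor_counit_comul, TensorProduct.lid_tmul, one_smul]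

@[simp] theorem applySnd_counit_comul (x : A) : applySnd (counit (R := k)) (comul x) = x := by
  rw [← rid_lTensor, lTensor_counit_comul, TensorProduct.rid_tmul, one_smul]

theorem comul_injective : Function.Injective (comul (R := k) (A := A)) :=
  Function.LeftInverse.injective applyFst_counit_comul

theorem comul_eq_one_mul (x : A) : comul (R := k) x = comul 1 * comul x := by
  rw [← comul_mul, one_mul]

theorem comul_eq_mul_one (x : A) : comul (R := k) x = comul x * comul 1 := by
  rw [← comul_mul, mul_one]

variable (k A) in
/-- `Π^L`, as a linear map. -/
def piLHom : A →ₗ[k] A := LinearMap.id ⋆ S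

variable (k A) in
/-- `Π^R`, as a linear map. -/
def piRHom : A →ₗ[k] A := S ⋆ LinearMap.id

theorem piLHom_apply (x : A) : piLHom k A x = piL k x := mul_antipode x

theorem piRHom_apply (x : A) : piRHom k A x = piR k x := antipode_mul x

theorem convMul_piRHom_antipode : piRHom k A ⋆ S = S := by
  ext x
  refine Eq.trans ?_ (antipode_mul_antipode (k := k) x)
  rw [convMul_apply, ← LinearMap.comp_apply (TensorProduct.map _ _) (TensorProduct.map _ _),
    ← TensorProduct.map_comp]
  rfl

theorem convMul_antipode_piLHom : S ⋆ piLHom k A = S := by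
  rw [piLHom, ← convMul_assoc, ← piRHom, convMul_piRHom_antipode]

variable (k) in
/-- `x ↦ 1₍₁₎ ε(1₍₂₎ x)`, the variant of `Π^L` with values in `A^R`. -/
def piLBar (x : A) : A := applySnd (counit ∘ₗ LinearMap.mulRight k x) (comul (R := k) 1)

variable (k) in
/-- `x ↦ ε(x 1₍₁₎) 1₍₂₎`, the variant of `Π^R` with values in `A^L`. -/
def piRBar (x : A) : A := applyFst (counit ∘ₗ LinearMap.mulLeft k x) (comul (R := k) 1)

theorem counit_mul_piL (x y : A) : counit (R := k) (x * piL k y) = counit (R := k) (x * y) := by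
  rw [← mul_one x, counit_mul_mul' (k := k) x 1 y, mul_one]
  exact apply_applyFst _ (counit ∘ₗ LinearMap.mulLeft k x) _

theorem counit_piR_mul (x y : A) : counit (R := k) (piR k x * y) = counit (R := k) (x * y) := by
  rw [← mul_one x, counit_mul_mul' (k := k) x 1 y, mul_one]
  exact apply_applySnd _ (counit ∘ₗ LinearMap.mulRight k y) _

theorem counit_mul_piLBar (x y : A) :
    counit (R := k) (x * piLBar k y) = counit (R := k) (x * y) := by
  rw [← mul_one x, counit_mul_mul (k := k) x 1 y, mul_one]
  exact apply_applySnd _ (counit ∘ₗ LinearMap.mulLeft k x) _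

theorem counit_piRBar_mul (x y : A) :
    counit (R := k) (piRBar k x * y) = counit (R := k) (x * y) := by
  rw [← mul_one x, counit_mul_mul (k := k) x 1 y, mul_one]
  exact apply_applyFst _ (counit ∘ₗ LinearMap.mulRight k y) _

theorem piL_congr {x y : A} (h : ∀ a : A, counit (R := k) (a * x) = counit (R := k) (a * y)) :
    piL k x = piL k y := by
  unfold piL; congr 2; ext a; exact h a

theorem piR_congr {x y : A} (h : ∀ a : A, counit (R := k) (x * a) = counit (R := k) (y * a)) :
    piR k x = piR k y := by
  unfold piR; congr 2; ext a; exact h a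

theorem piL_mul_piL (x y : A) : piL k (x * piL k y) = piL k (x * y) :=
  piL_congr fun a => by rw [← mul_assoc, counit_mul_piL, mul_assoc]

theorem piR_piR_mul (x y : A) : piR k (piR k x * y) = piR k (x * y) :=
  piR_congr fun a => by rw [mul_assoc, counit_piR_mul, mul_assoc]

theorem piL_piLBar (x : A) : piL k (piLBar k x) = piL k x :=
  piL_congr fun a => counit_mul_piLBar a x

theorem piR_piRBar (x : A) : piR k (piRBar k x) = piR k x :=
  piR_congr fun a => counit_piRBar_mul x a

theorem apply_piL (φ : Module.Dual k A) (a : A) :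
    φ (piL k a) = counit (R := k) (applySnd φ (comul 1) * a) := by
  rw [piL, apply_applyFst]
  exact (apply_applySnd φ (counit ∘ₗ LinearMap.mulRight k a) _).symm

theorem apply_piR (φ : Module.Dual k A) (a : A) :
    φ (piR k a) = counit (R := k) (a * applyFst φ (comul 1)) := by
  rw [piR, apply_applySnd]
  exact (apply_applyFst φ (counit ∘ₗ LinearMap.mulLeft k a) _).symm

theorem apply_piLBar (φ : Module.Dual k A) (a : A) :
    φ (piLBar k a) = counit (R := k) (applyFst φ (comul 1) * a) := by
  rw [piLBar, apply_applySnd]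
  exact (apply_applyFst φ (counit ∘ₗ LinearMap.mulRight k a) _).symm

/-- The subalgebra of the `y` with `Δ(y) = ι(y) Δ(1) = Δ(1) ι(y)`. The base algebras `A^L` and
`A^R` are the cases in which `ι` is one of the two inclusions of `A` into `A ⊗ A`. -/
def comulBase (ι : A →ₐ[k] A ⊗[k] A) : Subalgebra k A where
  carrier := {y | comul (R := k) y = ι y * comul 1 ∧ comul (R := k) y = comul 1 * ι y}
  mul_mem' := by
    rintro x y ⟨hx, hx'⟩ ⟨hy, hy'⟩
    constructor
    · rw [comul_mul, hx, mul_assoc, ← comul_eq_one_mul, hy, map_mul, mul_assoc]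
    · rw [comul_mul, hy', ← mul_assoc, ← comul_eq_mul_one, hx', map_mul, mul_assoc]
  add_mem' := by
    rintro x y ⟨hx, hx'⟩ ⟨hy, hy'⟩
    exact ⟨by rw [map_add, hx, hy, map_add, add_mul], by rw [map_add, hx', hy', map_add, mul_add]⟩
  algebraMap_mem' r := by
    simp [Algebra.algebraMap_eq_smul_one]

theorem comul_mul_of_mem_comulBase {ι : A →ₐ[k] A ⊗[k] A} {y : A} (hy : y ∈ comulBase ι) (x : A) :
    comul (R := k) (y * x) = ι y * comul x := by
  rw [comul_mul, hy.1, mul_assoc, ← comul_eq_one_mul]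

theorem comul_mul_of_mem_comulBase' {ι : A →ₐ[k] A ⊗[k] A} {y : A} (hy : y ∈ comulBase ι)
    (x : A) : comul (R := k) (x * y) = comul x * ι y := by
  rw [comul_mul, hy.2, ← mul_assoc, ← comul_eq_mul_one]

variable (k A) in
/-- The left base algebra `A^L`, characterized by `Δ(y) = y 1₍₁₎ ⊗ 1₍₂₎ = 1₍₁₎ y ⊗ 1₍₂₎`. -/
def baseL : Subalgebra k A := comulBase Algebra.TensorProduct.includeLeft

variable (k A) in
/-- The right base algebra `A^R`, characterized by `Δ(y) = 1₍₁₎ ⊗ y 1₍₂₎ = 1₍₁₎ ⊗ 1₍₂₎ y`. -/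
def baseR : Subalgebra k A := comulBase Algebra.TensorProduct.includeRight

theorem mem_baseL {y : A} : y ∈ baseL k A ↔
    comul (R := k) y = (y ⊗ₜ 1) * comul 1 ∧ comul (R := k) y = comul 1 * (y ⊗ₜ 1) := Iff.rfl

theorem mem_baseR {y : A} : y ∈ baseR k A ↔
    comul (R := k) y = (1 ⊗ₜ y) * comul 1 ∧ comul (R := k) y = comul 1 * (1 ⊗ₜ y) := Iff.rfl

theorem comul_baseL_mul {y : A} (hy : y ∈ baseL k A) (x : A) :
    comul (R := k) (y * x) = (y ⊗ₜ 1) * comul x := comul_mul_of_mem_comulBase hy x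

theorem comul_mul_baseL {y : A} (hy : y ∈ baseL k A) (x : A) :
    comul (R := k) (x * y) = comul x * (y ⊗ₜ 1) := comul_mul_of_mem_comulBase' hy x

theorem comul_baseR_mul {y : A} (hy : y ∈ baseR k A) (x : A) :
    comul (R := k) (y * x) = (1 ⊗ₜ y) * comul x := comul_mul_of_mem_comulBase hy x

theorem comul_mul_baseR {y : A} (hy : y ∈ baseR k A) (x : A) :
    comul (R := k) (x * y) = comul x * (1 ⊗ₜ y) := comul_mul_of_mem_comulBase' hy x

theorem commute_baseL_baseR {x y : A} (hx : x ∈ baseL k A) (hy : y ∈ baseR k A) :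
    Commute x y := by
  apply comul_injective (k := k)
  rw [comul_baseL_mul hx, comul_baseR_mul hy, (mem_baseL.1 hx).1, (mem_baseR.1 hy).1,
    ← mul_assoc, ← mul_assoc]
  simp

theorem piL_of_mem {y : A} (hy : y ∈ baseL k A) : piL k y = y := by
  rw [piL, ← applyFst_mul_tmul_one, ← (mem_baseL.1 hy).2, applyFst_counit_comul]

theorem piR_of_mem {y : A} (hy : y ∈ baseR k A) : piR k y = y := by
  rw [piR, ← applySnd_one_tmul_mul, ← (mem_baseR.1 hy).1, applySnd_counit_comul]

theorem comul_applyFst (φ : Module.Dual k A) (x : A) :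
    TensorProduct.map (applyFst φ) LinearMap.id (TensorProduct.map comul LinearMap.id (comul x)) =
      comul (R := k) (applyFst φ (comul x)) := by
  have coassoc := coassoc_symm_apply (R := k) x
  rw [LinearMap.rTensor] at coassoc
  rw [← coassoc]
  induction comul (R := k) x <;> simp_all [map_applyFst_assoc_symm_tmul]

theorem comul_applySnd (φ : Module.Dual k A) (x : A) :
    TensorProduct.map LinearMap.id (applySnd φ) (TensorProduct.assoc k A A A
      (TensorProduct.map comul LinearMap.id (comul x))) =
      comul (R := k) (applySnd φ (comul x)) := by
  induction comul (R := k) x <;> simp_all [map_applySnd_assoc_tmul]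

theorem applyFst_comul_one_mem (φ : Module.Dual k A) : applyFst φ (comul 1) ∈ baseL k A := by
  rw [mem_baseL, ← comul_applyFst]
  constructor
  · rw [comul_comul_one, ← (ℛ k (1 : A)).eq]
    simp [sum_tmul, tmul_sum, Finset.sum_mul_sum]
  · rw [comul_comul_one', ← (ℛ k (1 : A)).eq]
    simp [sum_tmul, tmul_sum, Finset.sum_mul_sum]

theorem applySnd_comul_one_mem (φ : Module.Dual k A) : applySnd φ (comul 1) ∈ baseR k A := by
  rw [mem_baseR, ← comul_applySnd]
  constructor
  · rw [comul_comul_one', ← (ℛ k (1 : A)).eq]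
    simp [sum_tmul, tmul_sum, Finset.sum_mul_sum]
  · rw [comul_comul_one, ← (ℛ k (1 : A)).eq]
    simp [sum_tmul, tmul_sum, Finset.sum_mul_sum]

theorem piL_mem (x : A) : piL k x ∈ baseL k A := applyFst_comul_one_mem _

theorem piR_mem (x : A) : piR k x ∈ baseR k A := applySnd_comul_one_mem _

theorem piLBar_mem (x : A) : piLBar k x ∈ baseR k A := applySnd_comul_one_mem _

theorem piRBar_mem (x : A) : piRBar k x ∈ baseL k A := applyFst_comul_one_mem _

theorem map_id_piL_comul_one :
    TensorProduct.map LinearMap.id (piLHom k A) (comul (R := k) (1 : A)) = comul 1 :=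
  ext_applyFst fun φ => by
    rw [applyFst_map, piLHom_apply, LinearMap.comp_id, piL_of_mem (applyFst_comul_one_mem φ)]

theorem map_piR_id_comul_one :
    TensorProduct.map (piRHom k A) LinearMap.id (comul (R := k) (1 : A)) = comul 1 :=
  ext_applySnd fun φ => by
    rw [applySnd_map, piRHom_apply, LinearMap.comp_id, piR_of_mem (applySnd_comul_one_mem φ)]

variable (k A) in
theorem exists_repr_one : ∃ r : Coalgebra.Repr k (1 : A) (A × A),
    (∀ i, r.left i ∈ baseR k A) ∧ ∀ i, r.right i ∈ baseL k A := by
  let r := ℛ k (1 : A)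
  refine ⟨⟨r.index, fun i => piR k (r.left i), fun i => piL k (r.right i), ?_⟩,
    fun i => piR_mem _, fun i => piL_mem _⟩
  conv_rhs => rw [← map_piR_id_comul_one, ← map_id_piL_comul_one, ← r.eq]
  simp [piLHom_apply, piRHom_apply]

/-! ### The antipode -/

theorem map_id_piL_comul (x : A) :
    TensorProduct.map LinearMap.id (piLHom k A) (comul (R := k) x) = comul 1 * (x ⊗ₜ 1) := by
  refine ext_applySnd fun φ => ?_
  have apply_comp_piL : φ ∘ₗ piLHom k A = counit ∘ₗ LinearMap.mulLeft k (applySnd φ (comul 1)) := by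
    ext a; simp [piLHom_apply, apply_piL]
  rw [applySnd_map, apply_comp_piL, ← applySnd_one_tmul_mul,
    ← comul_baseR_mul (applySnd_comul_one_mem φ), applySnd_counit_comul, applySnd_mul_tmul_one,
    LinearMap.id_apply]

theorem map_piR_id_comul (x : A) :
    TensorProduct.map (piRHom k A) LinearMap.id (comul (R := k) x) = (1 ⊗ₜ x) * comul 1 := by
  refine ext_applyFst fun φ => ?_
  have apply_comp_piR :
      φ ∘ₗ piRHom k A = counit ∘ₗ LinearMap.mulRight k (applyFst φ (comul 1)) := by
    ext a; simp [piRHom_apply, apply_piR]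
  rw [applyFst_map, apply_comp_piR, ← applyFst_mul_tmul_one,
    ← comul_mul_baseL (applyFst_comul_one_mem φ), applyFst_counit_comul, applyFst_one_tmul_mul,
    LinearMap.id_apply]

theorem applyFst_comp_piLBar_comul {φ ψ : Module.Dual k A} (h : ∀ a, ψ a = φ (piLBar k a))
    (x : A) : applyFst ψ (comul x) = applyFst φ (comul 1) * x := by
  have hψ : ψ = counit ∘ₗ LinearMap.mulLeft k (applyFst φ (comul 1)) := by
    ext a; simp [h, apply_piLBar]
  rw [hψ, ← applyFst_tmul_one_mul, ← comul_baseL_mul (applyFst_comul_one_mem φ),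
    applyFst_counit_comul]

theorem mul'_map_piL_id (t : A ⊗[k] A) :
    LinearMap.mul' k A (TensorProduct.map (piLHom k A) LinearMap.id t) =
      applyFst counit (comul (R := k) 1 * t) := by
  induction t with
  | zero => simp
  | add s t hs ht => simp only [mul_add, map_add, hs, ht]
  | tmul a b =>
    have tmul_eq : a ⊗ₜ[k] b = (a ⊗ₜ 1) * (1 ⊗ₜ b) := by simp
    rw [tmul_eq, ← mul_assoc, applyFst_mul_one_tmul, applyFst_mul_tmul_one, ← tmul_eq]
    simp [piLHom_apply, piL]

theorem convMul_piLHom_id : piLHom k A ⋆ LinearMap.id = LinearMap.id := by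
  ext x
  rw [convMul_apply, mul'_map_piL_id, ← comul_eq_one_mul, applyFst_counit_comul, LinearMap.id_apply]

theorem convMul_tmul {B : Type*} [Ring B] [Algebra k B] (F G : A ⊗[k] A →ₗ[k] B) (x y : A) :
    (F ⋆ G) (x ⊗ₜ y) = ∑ i ∈ (ℛ k x).index, ∑ j ∈ (ℛ k y).index,
      F ((ℛ k x).left i ⊗ₜ (ℛ k y).left j) * G ((ℛ k x).right i ⊗ₜ (ℛ k y).right j) := by
  rw [convMul_apply, TensorProduct.comul_tmul]
  conv_lhs => rw [← (ℛ k x).eq, ← (ℛ k y).eq]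
  simp [sum_tmul, tmul_sum, Finset.sum_comm (s := (ℛ k y).index)]

theorem convMul_comp_mul' (p q : A →ₗ[k] A) :
    (p ∘ₗ LinearMap.mul' k A) ⋆ (q ∘ₗ LinearMap.mul' k A) = (p ⋆ q) ∘ₗ LinearMap.mul' k A := by
  refine TensorProduct.ext' fun x y => ?_
  rw [convMul_tmul, LinearMap.comp_apply, LinearMap.mul'_apply, convMul_apply, comul_mul]
  conv_rhs => rw [← (ℛ k x).eq, ← (ℛ k y).eq]
  simp [Finset.sum_mul_sum]

variable (k A) in
/-- The linear map `x ⊗ y ↦ S(y) ⊗ S(x)`. It expresses both that `S` is antimultiplicative and that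
it is anticomultiplicative. -/
def antipodeTwist : A ⊗[k] A →ₗ[k] A ⊗[k] A :=
  (TensorProduct.comm k A A).toLinearMap ∘ₗ TensorProduct.map S S

@[simp] theorem antipodeTwist_tmul (x y : A) :
    antipodeTwist k A (x ⊗ₜ y) = S y ⊗ₜ S x := by
  simp [antipodeTwist]

theorem piL_eq_sum (x : A) {ι : Type*} (r : Coalgebra.Repr k x ι) :
    piL k x = ∑ i ∈ r.index, r.left i * S (r.right i) := by
  rw [← piLHom_apply, piLHom, convMul_repr _ _ r]; simp

theorem piR_eq_sum (x : A) {ι : Type*} (r : Coalgebra.Repr k x ι) :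
    piR k x = ∑ i ∈ r.index, S (r.left i) * r.right i := by
  rw [← piRHom_apply, piRHom, convMul_repr _ _ r]; simp

section MulTwist

local notation "mul" => LinearMap.mul' k A
local notation "mulTwist" => LinearMap.mul' k A ∘ₗ antipodeTwist k A

theorem piL_mul_eq_sum (x y : A) {ι : Type*} (r : Coalgebra.Repr k x ι) :
    piL k (x * y) = ∑ i ∈ r.index, r.left i * piL k y * S (r.right i) := by
  rw [← piL_mul_piL, ← piLHom_apply, piLHom, convMul_apply, comul_mul_baseL (piL_mem y), ← r.eq]
  simp [Finset.sum_mul]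

theorem piR_mul_eq_sum (x y : A) {ι : Type*} (r : Coalgebra.Repr k y ι) :
    piR k (x * y) = ∑ i ∈ r.index, S (r.left i) * (piR k x * r.right i) := by
  rw [← piR_piR_mul, ← piRHom_apply, piRHom, convMul_apply, comul_baseR_mul (piR_mem x), ← r.eq]
  simp [Finset.mul_sum]

theorem convMul_mul_mulTwist : mul ⋆ mulTwist = piLHom k A ∘ₗ mul := by
  refine TensorProduct.ext' fun x y => ?_
  rw [convMul_tmul, LinearMap.comp_apply, LinearMap.mul'_apply, piLHom_apply,
    piL_mul_eq_sum x y (ℛ k x), piL_eq_sum y (ℛ k y)]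
  simp [Finset.mul_sum, Finset.sum_mul, mul_assoc]

theorem convMul_mulTwist_mul : mulTwist ⋆ mul = piRHom k A ∘ₗ mul := by
  refine TensorProduct.ext' fun x y => ?_
  rw [convMul_tmul, LinearMap.comp_apply, LinearMap.mul'_apply, piRHom_apply,
    piR_mul_eq_sum x y (ℛ k y), piR_eq_sum x (ℛ k x), Finset.sum_comm]
  simp [Finset.mul_sum, Finset.sum_mul, mul_assoc]

theorem convMul_mulLeft_convMul_antipode {a : A} (ha : a ∈ baseR k A) (y : A) :
    (S ⋆ LinearMap.mulLeft k a ⋆ S) y = S y * a := by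
  conv_rhs => rw [← convMul_antipode_piLHom]
  rw [convMul_assoc, ← LinearMap.comp_id (LinearMap.mulLeft k a), mulLeft_comp_convMul, ← piLHom,
    convMul_repr _ _ (ℛ k y), convMul_repr _ _ (ℛ k y), Finset.sum_mul]
  refine Finset.sum_congr rfl fun j _ => ?_
  rw [LinearMap.comp_apply, LinearMap.mulLeft_apply, piLHom_apply,
    ← (commute_baseL_baseR (piL_mem _) ha).eq, mul_assoc]

theorem convMul_mulTwist_mul_apply (x y : A) :
    (mulTwist ⋆ mul) (x ⊗ₜ y) = (S ⋆ LinearMap.mulLeft k (piR k x)) y := by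
  rw [convMul_mulTwist_mul, convMul_repr _ _ (ℛ k y)]
  simpa [piRHom_apply] using piR_mul_eq_sum x y (ℛ k y)

theorem convMul_mulTwist_mul_mulTwist : mulTwist ⋆ mul ⋆ mulTwist = mulTwist := by
  refine TensorProduct.ext' fun x y => ?_
  have antipode_eq_sum :
      S x = ∑ i ∈ (ℛ k x).index, piR k ((ℛ k x).left i) * S ((ℛ k x).right i) := by
    conv_lhs => rw [← convMul_piRHom_antipode, convMul_repr _ _ (ℛ k x)]
    simp only [piRHom_apply]
  calc (mulTwist ⋆ mul ⋆ mulTwist) (x ⊗ₜ y)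
      = ∑ i ∈ (ℛ k x).index, (S ⋆ LinearMap.mulLeft k (piR k ((ℛ k x).left i)) ⋆ S) y *
          S ((ℛ k x).right i) := by
        rw [convMul_tmul]
        refine Finset.sum_congr rfl fun i _ => ?_
        rw [convMul_repr _ _ (ℛ k y), Finset.sum_mul]
        refine Finset.sum_congr rfl fun j _ => ?_
        simp [convMul_mulTwist_mul_apply, mul_assoc]
    _ = S y * S x := by
        simp only [convMul_mulLeft_convMul_antipode (piR_mem _), antipode_eq_sum, Finset.mul_sum,
          mul_assoc]
    _ = mulTwist (x ⊗ₜ y) := by simp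

theorem antipode_mul_rev (x y : A) : S (x * y) = S y * S x := by
  have left_eq : (S ∘ₗ mul) ⋆ mul = mulTwist ⋆ mul := by
    rw [convMul_mulTwist_mul, piRHom, ← convMul_comp_mul', LinearMap.id_comp]
  have right_eq : mul ⋆ (S ∘ₗ mul) = mul ⋆ mulTwist := by
    rw [convMul_mul_mulTwist, piLHom, ← convMul_comp_mul', LinearMap.id_comp]
  have key : S ∘ₗ mul = mulTwist := by
    refine eq_of_convMul_convMul_eq ?_ right_eq ?_
    · rw [left_eq, convMul_mulTwist_mul, convMul_comp_mul', convMul_piRHom_antipode]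
    · rw [left_eq, convMul_mulTwist_mul_mulTwist]
  simpa using LinearMap.congr_fun key (x ⊗ₜ y)

end MulTwist

theorem antipode_of_mem_baseR {y : A} (hy : y ∈ baseR k A) : S y = piL k y := by
  have piL_one : piL k (1 : A) = 1 := piL_of_mem (one_mem _)
  have piL_eq : piL k y = piL k 1 * S y := by
    rw [← piLHom_apply, ← piLHom_apply, piLHom, convMul_apply, convMul_apply, (mem_baseR.1 hy).1,
      ← (ℛ k (1 : A)).eq]
    simp [Finset.mul_sum, Finset.sum_mul, antipode_mul_rev, mul_assoc]
  rw [piL_eq, piL_one, one_mul]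

theorem antipode_of_mem_baseL {y : A} (hy : y ∈ baseL k A) : S y = piR k y := by
  have piR_one : piR k (1 : A) = 1 := piR_of_mem (one_mem _)
  have piR_eq : piR k y = S y * piR k 1 := by
    rw [← piRHom_apply, ← piRHom_apply, piRHom, convMul_apply, convMul_apply, (mem_baseL.1 hy).2,
      ← (ℛ k (1 : A)).eq]
    simp [Finset.mul_sum, Finset.sum_mul, antipode_mul_rev, mul_assoc]
  rw [piR_eq, piR_one, mul_one]

theorem antipode_one : S 1 = 1 := by
  rw [antipode_of_mem_baseR (one_mem _), piL_of_mem (one_mem _)]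

theorem antipode_mem_baseL {y : A} (hy : y ∈ baseR k A) : S y ∈ baseL k A := by
  rw [antipode_of_mem_baseR hy]; exact piL_mem y

theorem antipode_mem_baseR {y : A} (hy : y ∈ baseL k A) : S y ∈ baseR k A := by
  rw [antipode_of_mem_baseL hy]; exact piR_mem y

theorem counit_antipode_of_mem_baseR {y : A} (hy : y ∈ baseR k A) :
    counit (R := k) (S y) = counit (R := k) y := by
  simpa [antipode_of_mem_baseR hy] using counit_mul_piL (k := k) 1 y

theorem counit_antipode_of_mem_baseL {y : A} (hy : y ∈ baseL k A) :
    counit (R := k) (S y) = counit (R := k) y := by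
  simpa [antipode_of_mem_baseL hy] using counit_piR_mul (k := k) y 1

theorem antipodeTwist_mul (s t : A ⊗[k] A) :
    antipodeTwist k A (s * t) = antipodeTwist k A t * antipodeTwist k A s := by
  induction s with
  | zero => simp
  | add s s' hs hs' => simp only [add_mul, mul_add, map_add, hs, hs']
  | tmul a b => induction t <;> simp_all [mul_add, add_mul, antipode_mul_rev]

theorem antipodeTwist_comul_one : antipodeTwist k A (comul 1) = comul 1 := by
  refine ext_applyFst fun φ => ?_
  obtain ⟨r, -, hr⟩ := exists_repr_one k A
  have apply_antipode : applySnd (φ ∘ₗ S) (comul 1) = piLBar k (applyFst φ (comul 1)) := by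
    rw [piLBar]
    conv_lhs => rw [← r.eq]
    conv_rhs => arg 2; rw [← r.eq]
    simp only [map_sum, applySnd_tmul]
    refine Finset.sum_congr rfl fun i _ => ?_
    rw [LinearMap.comp_apply, antipode_of_mem_baseL (hr i), apply_piR]
    rfl
  rw [antipodeTwist, LinearMap.comp_apply, LinearEquiv.coe_coe, applyFst_comm, applySnd_map,
    apply_antipode, antipode_of_mem_baseR (piLBar_mem _), piL_piLBar,
    piL_of_mem (applyFst_comul_one_mem φ)]

local notation "ι₁" => AlgHom.toLinearMap (Algebra.TensorProduct.includeLeft : A →ₐ[k] A ⊗[k] A)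
local notation "ι₂" => AlgHom.toLinearMap (Algebra.TensorProduct.includeRight : A →ₐ[k] A ⊗[k] A)

theorem comul_comp_convMul (f g : A →ₗ[k] A) :
    comul (R := k) ∘ₗ (f ⋆ g) = (comul ∘ₗ f) ⋆ (comul ∘ₗ g) := by
  ext x
  simp [convMul_repr _ _ (ℛ k x), comul_mul]

theorem comul_eq_convMul : comul (R := k) (A := A) = ι₁ ⋆ ι₂ := by
  ext x
  rw [convMul_repr _ _ (ℛ k x), ← (ℛ k x).eq]
  simp

theorem antipodeTwist_comp_comul :
    antipodeTwist k A ∘ₗ comul = (ι₂ ∘ₗ S) ⋆ (ι₁ ∘ₗ S) := by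
  ext x
  rw [LinearMap.comp_apply, convMul_repr _ _ (ℛ k x)]
  conv_lhs => rw [← (ℛ k x).eq]
  simp

theorem convMul_includeLeft_piLHom :
    ι₁ ⋆ (ι₂ ∘ₗ piLHom k A) =
      LinearMap.mulLeft k (comul 1) ∘ₗ ι₁ := by
  ext x
  refine Eq.trans ?_ (map_id_piL_comul x)
  rw [convMul_repr _ _ (ℛ k x), ← (ℛ k x).eq]
  simp

theorem algHom_convMul_comp_antipode {B : Type*} [Ring B] [Algebra k B] (ι : A →ₐ[k] B) :
    ι.toLinearMap ⋆ (ι.toLinearMap ∘ₗ S) = ι.toLinearMap ∘ₗ piLHom k A := by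
  rw [piLHom, algHom_comp_convMul, LinearMap.comp_id]

theorem comul_convMul_antipodeTwist :
    comul ⋆ (antipodeTwist k A ∘ₗ comul) = comul ∘ₗ piLHom k A := by
  calc comul ⋆ (antipodeTwist k A ∘ₗ comul)
      = ι₁ ⋆ (ι₂ ⋆ (ι₂ ∘ₗ S)) ⋆ (ι₁ ∘ₗ S) := by
        rw [antipodeTwist_comp_comul, comul_eq_convMul]; simp only [convMul_assoc]
    _ = LinearMap.mulLeft k (comul 1) ∘ₗ ι₁ ∘ₗ piLHom k A := by
        rw [algHom_convMul_comp_antipode, convMul_includeLeft_piLHom, mulLeft_comp_convMul,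
          algHom_convMul_comp_antipode]
    _ = comul ∘ₗ piLHom k A := by
        ext x
        simpa [piLHom_apply] using (mem_baseL.1 (piL_mem (k := k) x)).2.symm

theorem comul_comp_piRHom : comul ∘ₗ piRHom k A =
    LinearMap.mulLeft k (comul 1) ∘ₗ ι₂ ∘ₗ piRHom k A := by
  ext x
  simpa [piRHom_apply] using (mem_baseR.1 (piR_mem (k := k) x)).2

theorem comul_piR_convMul_antipodeTwist :
    (comul ∘ₗ piRHom k A) ⋆ (antipodeTwist k A ∘ₗ comul) = antipodeTwist k A ∘ₗ comul := by
  rw [comul_comp_piRHom, mulLeft_comp_convMul, antipodeTwist_comp_comul, ← convMul_assoc,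
    ← algHom_comp_convMul, convMul_piRHom_antipode, ← antipodeTwist_comp_comul]
  ext x
  simp only [LinearMap.comp_apply, LinearMap.mulLeft_apply]
  conv_rhs => rw [comul_eq_mul_one x, antipodeTwist_mul, antipodeTwist_comul_one]

theorem comul_antipode (x : A) : comul (S x) = antipodeTwist k A (comul x) := by
  have comul_comp_piR : (comul ∘ₗ S) ⋆ comul (R := k) = comul ∘ₗ piRHom k A := by
    rw [piRHom, comul_comp_convMul, LinearMap.comp_id]
  have comul_comp_piL : comul (R := k) ⋆ (comul ∘ₗ S) = comul ∘ₗ piLHom k A := by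
    rw [piLHom, comul_comp_convMul, LinearMap.comp_id]
  refine LinearMap.congr_fun (eq_of_convMul_convMul_eq (f := comul) (g := comul ∘ₗ S)
    (g' := antipodeTwist k A ∘ₗ comul) ?_ ?_ ?_) x
  · rw [comul_comp_piR, ← comul_comp_convMul, convMul_piRHom_antipode]
  · rw [comul_comp_piL, comul_convMul_antipodeTwist]
  · rw [comul_comp_piR, comul_piR_convMul_antipodeTwist]

theorem piL_antipode (x : A) : piL k (S x) = S (piR k x) := by
  rw [← piLHom_apply, ← piRHom_apply, piLHom, piRHom, convMul_apply, convMul_apply, comul_antipode,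
    ← (ℛ k x).eq]
  simp [antipode_mul_rev]

theorem piR_antipode (x : A) : piR k (S x) = S (piL k x) := by
  rw [← piLHom_apply, ← piRHom_apply, piLHom, piRHom, convMul_apply, convMul_apply, comul_antipode,
    ← (ℛ k x).eq]
  simp [antipode_mul_rev]

theorem counit_piL (x : A) : counit (R := k) (piL k x) = counit (R := k) x := by
  simpa using counit_mul_piL (k := k) 1 x

theorem counit_piR (x : A) : counit (R := k) (piR k x) = counit (R := k) x := by
  simpa using counit_piR_mul (k := k) x 1

theorem applySnd_comul_antipode (φ : Module.Dual k A) (x : A) :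
    applySnd φ (comul (S x)) = S (applyFst (φ ∘ₗ S) (comul x)) := by
  rw [comul_antipode, antipodeTwist, LinearMap.comp_apply, LinearEquiv.coe_coe, applySnd_comm,
    applyFst_map]

theorem applySnd_comul_applyFst (φ ψ : Module.Dual k A) (x : A) :
    applySnd φ (comul (applyFst ψ (comul x))) = applyFst ψ (comul (applySnd φ (comul x))) := by
  rw [← comul_applyFst, ← comul_applySnd]
  induction TensorProduct.map comul LinearMap.id (comul (R := k) x) with
  | zero => simp
  | add s t hs ht => simp only [map_add, hs, ht]
  | tmul s c =>
    induction s with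
    | zero => simp
    | tmul a b => simp [smul_smul]
    | add s t hs ht => simp only [add_tmul, map_add, hs, ht]

theorem mem_baseR_of_antipode_mem (hS : Function.Injective S) {y : A} (hy : S y ∈ baseL k A) :
    y ∈ baseR k A := by
  have piR_eq : piR k y = y := hS (by rw [← piL_antipode, piL_of_mem hy])
  exact piR_eq ▸ piR_mem y

theorem exists_antipode_eq (hS : Function.Surjective S) {y : A} (hy : y ∈ baseR k A) :
    ∃ x ∈ baseL k A, S x = y := by
  obtain ⟨x, rfl⟩ := hS y
  exact ⟨piL k x, piL_mem x, by rw [← piR_antipode, piR_of_mem hy]⟩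

theorem comul_one_mul_tmul_one {z : A} (hz : z ∈ baseR k A) :
    comul (R := k) 1 * (z ⊗ₜ 1) = comul 1 * (1 ⊗ₜ S z) := by
  obtain ⟨r, -, hr⟩ := exists_repr_one k A
  rw [← map_id_piL_comul, (mem_baseR.1 hz).2, ← r.eq]
  simp only [Finset.sum_mul, Algebra.TensorProduct.tmul_mul_tmul, map_sum, TensorProduct.map_tmul,
    mul_one, LinearMap.id_apply, piLHom_apply]
  refine Finset.sum_congr rfl fun i _ => ?_
  rw [← piL_mul_piL, piL_of_mem (mul_mem (hr i) (piL_mem z)), antipode_of_mem_baseR hz]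

/-! ### Haar integrals -/

theorem IsHaarIntegral.eq {h h' : A} (hh : IsHaarIntegral k h) (hh' : IsHaarIntegral k h') :
    h = h' := by
  calc h = h' * h := by rw [hh.left_integral, hh'.left_normalized, one_mul]
    _ = h' := by rw [hh'.right_integral, hh.right_normalized, mul_one]

theorem comul_convMul_includeRight_antipode :
    comul ⋆ (ι₂ ∘ₗ S) = LinearMap.mulLeft k (comul 1) ∘ₗ ι₁ := by
  rw [← convMul_includeLeft_piLHom, ← algHom_convMul_comp_antipode, ← convMul_assoc,
    ← comul_eq_convMul]

variable (k) in
/-- The tensor `S(h₍₁₎) ⊗ h₍₂₎`; for a Haar integral `h` it is a separability idempotent of `A`, by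
`IsHaarIntegral.mul'_casimir` and `IsHaarIntegral.tmul_one_mul_casimir`. -/
def casimir (h : A) : A ⊗[k] A := TensorProduct.map S LinearMap.id (comul h)

theorem map_antipode_mul_tmul_one (s : A ⊗[k] A) (x : A) :
    TensorProduct.map S LinearMap.id (s * (x ⊗ₜ 1)) =
      (S x ⊗ₜ 1) * TensorProduct.map S LinearMap.id s := by
  induction s <;> simp_all [antipode_mul_rev, add_mul, mul_add]

theorem map_antipode_mul_one_tmul (s : A ⊗[k] A) (x : A) :
    TensorProduct.map S LinearMap.id (s * (1 ⊗ₜ x)) =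
      TensorProduct.map S LinearMap.id s * (1 ⊗ₜ x) := by
  induction s <;> simp_all [add_mul]

theorem map_antipode_antipodeTwist (s : A ⊗[k] A) :
    TensorProduct.map S LinearMap.id (antipodeTwist k A s) =
      TensorProduct.map (S ∘ₗ S) LinearMap.id
        (TensorProduct.comm k A A (TensorProduct.map S LinearMap.id s)) := by
  induction s <;> simp_all

variable (k A) in
/-- The largest left ideal of `A` contained in the kernel of the counit. -/
def counitLeftIdeal : Ideal A where
  carrier := {x | ∀ a, counit (R := k) (a * x) = 0}
  add_mem' hx hy a := by rw [mul_add, map_add, hx, hy, add_zero]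
  zero_mem' a := by rw [mul_zero, map_zero]
  smul_mem' b x hx a := by rw [smul_eq_mul, ← mul_assoc, hx]

namespace IsHaarIntegral

variable {h : A} (hh : IsHaarIntegral k h)
include hh

theorem comul_mul_tmul_one (x : A) :
    comul (R := k) h * (x ⊗ₜ 1) = comul h * (1 ⊗ₜ S x) := by
  have comul_mul_comul : LinearMap.mulLeft k (comul h) ∘ₗ comul =
      LinearMap.mulLeft k (comul h) ∘ₗ ι₂ ∘ₗ piRHom k A := by
    ext x
    simpa [piRHom_apply, comul_mul, comul_mul_baseR (piR_mem x)] using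
      congrArg (comul (R := k)) (hh.right_integral x)
  have comul_mul_convMul :=
    calc LinearMap.mulLeft k (comul h) ∘ₗ LinearMap.mulLeft k (comul 1) ∘ₗ ι₁
        = (LinearMap.mulLeft k (comul h) ∘ₗ comul) ⋆ (ι₂ ∘ₗ S) := by
          rw [← comul_convMul_includeRight_antipode, mulLeft_comp_convMul]
      _ = LinearMap.mulLeft k (comul h) ∘ₗ ι₂ ∘ₗ (piRHom k A ⋆ S) := by
          rw [comul_mul_comul, algHom_comp_convMul, mulLeft_comp_convMul]
      _ = LinearMap.mulLeft k (comul h) ∘ₗ ι₂ ∘ₗ S := by rw [convMul_piRHom_antipode]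
  simpa [← mul_assoc, ← comul_eq_mul_one] using LinearMap.congr_fun comul_mul_convMul x

theorem mul'_casimir : LinearMap.mul' k A (casimir k h) = 1 := by
  rw [← hh.right_normalized, ← piRHom_apply]; rfl

variable (hS : Function.Surjective (antipode (k := k) (A := A)))
include hS

theorem antipode_eq : S h = h := by
  have antipode_haar : IsHaarIntegral k (S h) :=
    { left_integral := hS.forall.2 fun x => by
        rw [← antipode_mul_rev, hh.right_integral, antipode_mul_rev, piL_antipode]
      right_integral := hS.forall.2 fun x => by
        rw [← antipode_mul_rev, hh.left_integral, antipode_mul_rev, piR_antipode]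
      left_normalized := by rw [piL_antipode, hh.right_normalized, antipode_one]
      right_normalized := by rw [piR_antipode, hh.left_normalized, antipode_one] }
  exact antipode_haar.eq hh

theorem tmul_one_mul_casimir (y : A) : (y ⊗ₜ 1) * casimir k h = casimir k h * (1 ⊗ₜ y) := by
  obtain ⟨x, rfl⟩ := hS y
  rw [casimir, ← map_antipode_mul_tmul_one, hh.comul_mul_tmul_one, map_antipode_mul_one_tmul]

theorem casimir_eq_map_comm : casimir k h = TensorProduct.map (S ∘ₗ S) LinearMap.id
    (TensorProduct.comm k A A (casimir k h)) := by
  rw [casimir, ← map_antipode_antipodeTwist, ← comul_antipode, hh.antipode_eq hS]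

theorem applySnd_mulRight_casimir (φ : Module.Dual k A) (x : A) :
    applySnd (φ ∘ₗ LinearMap.mulRight k x) (casimir k h) = x * applySnd φ (casimir k h) := by
  rw [← applySnd_mul_one_tmul, ← hh.tmul_one_mul_casimir hS, applySnd_tmul_one_mul]

theorem mul'_comm_casimir (hSS : ∀ x : A, S (S x) = x) :
    LinearMap.mul' k A (TensorProduct.comm k A A (casimir k h)) = 1 := by
  have sq_eq_id : S ∘ₗ S = LinearMap.id := LinearMap.ext hSS
  have casimir_symm := hh.casimir_eq_map_comm hS
  rw [sq_eq_id, TensorProduct.map_id, LinearMap.id_apply] at casimir_symm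
  rw [← casimir_symm, hh.mul'_casimir]

end IsHaarIntegral

/-! ### Haar integrals and traces -/

/-- A Haar integral `h` together with a nondegenerate trace `tr`, on a weak Hopf algebra with
bijective antipode. These data suffice to construct the Haar functional by multiplying `tr` with
explicit densities. -/
structure IsTraceFrame (h : A) (tr : Module.Dual k A) : Prop where
  haar : IsHaarIntegral k h
  bijective : Function.Bijective S
  comm : ∀ x y, tr (x * y) = tr (y * x)
  nondegenerate : ∀ x, (∀ y, tr (y * x) = 0) → x = 0

/-- The element `d = S(h₍₁₎) tr(h₍₂₎)`. It implements `S²` as an inner automorphism, by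
`IsTraceFrame.mul_density`. -/
def density (h : A) (tr : Module.Dual k A) : A := applySnd tr (casimir k h)

/-- The functional `λ = tr(d⁻¹ ·)`, where `d = density h tr`. It is a nondegenerate, not necessarily
normalized, left integral of the dual weak Hopf algebra. -/
def dualIntegral (h : A) (tr : Module.Dual k A) : Module.Dual k A :=
  tr ∘ₗ LinearMap.mulLeft k (density h tr)⁻¹ʳ

theorem dualIntegral_apply (h : A) (tr : Module.Dual k A) (x : A) :
    dualIntegral h tr x = tr ((density h tr)⁻¹ʳ * x) := rfl

namespace IsTraceFrame

variable {h : A} {tr : Module.Dual k A} (F : IsTraceFrame h tr)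
include F

theorem applySnd_mulRight_casimir (x : A) :
    applySnd (tr ∘ₗ LinearMap.mulRight k x) (casimir k h) = x * density h tr :=
  F.haar.applySnd_mulRight_casimir F.bijective.2 tr x

theorem applyFst_mulLeft_casimir (y : A) :
    applyFst (tr ∘ₗ LinearMap.mulLeft k y) (casimir k h) = density h tr * y := by
  rw [← sub_eq_zero]
  refine F.nondegenerate _ fun x => ?_
  have trace_mul : tr (x * applyFst (tr ∘ₗ LinearMap.mulLeft k y) (casimir k h)) =
      tr (x * (density h tr * y)) :=
    calc tr (x * applyFst (tr ∘ₗ LinearMap.mulLeft k y) (casimir k h))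
        = tr (y * applySnd (tr ∘ₗ LinearMap.mulRight k x) (casimir k h)) := by
          rw [F.comm]
          exact (apply_applyFst _ (tr ∘ₗ LinearMap.mulRight k x) _).trans
            (apply_applySnd _ (tr ∘ₗ LinearMap.mulLeft k y) _).symm
      _ = tr (x * (density h tr * y)) := by
          rw [F.applySnd_mulRight_casimir, F.comm, mul_assoc]
  rw [mul_sub, map_sub, trace_mul, sub_self]

theorem mul_density_eq_antipode_antipode (x : A) :
    x * density h tr = S (S (density h tr * x)) := by
  have mulRight_eq : tr ∘ₗ LinearMap.mulRight k x = tr ∘ₗ LinearMap.mulLeft k x :=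
    LinearMap.ext fun a => F.comm a x
  rw [← F.applySnd_mulRight_casimir, F.haar.casimir_eq_map_comm F.bijective.2, applySnd_map,
    LinearMap.comp_id, applySnd_comm, mulRight_eq, F.applyFst_mulLeft_casimir]
  rfl

theorem mul_density (x : A) : x * density h tr = density h tr * S (S x) := by
  have antipode_antipode_density : S (S (density h tr)) = density h tr := by
    simpa using (F.mul_density_eq_antipode_antipode 1).symm
  rw [F.mul_density_eq_antipode_antipode, antipode_mul_rev, antipode_mul_rev,
    antipode_antipode_density]

theorem dualIntegral_mul_eq_trace (a b : A) :
    dualIntegral h tr (b * a) = tr (a * (density h tr)⁻¹ʳ * b) := by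
  rw [dualIntegral_apply, ← mul_assoc, F.comm, ← mul_assoc]

variable [FiniteDimensional k A]

theorem eq_zero_of_density_mul {x : A} (hx : density h tr * x = 0) : x = 0 := by
  have casimir_mul : casimir k h * (1 ⊗ₜ x) = 0 := by
    refine ext_applySnd fun φ => ?_
    obtain ⟨y, rfl⟩ := exists_eq_comp_mulRight F.nondegenerate φ
    have mulRight_comp : (tr ∘ₗ LinearMap.mulRight k y) ∘ₗ LinearMap.mulRight k x =
        tr ∘ₗ LinearMap.mulRight k (x * y) := by ext a; simp [mul_assoc]
    rw [applySnd_mul_one_tmul, mulRight_comp, F.applySnd_mulRight_casimir,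
      F.mul_density_eq_antipode_antipode, ← mul_assoc, hx]
    simp
  simpa [casimir_mul, F.haar.mul'_casimir] using (mul'_mul_one_tmul (casimir k h) x).symm

theorem isUnit_density : IsUnit (density h tr) :=
  isUnit_of_forall_mul_eq_zero k fun _ => F.eq_zero_of_density_mul

theorem inverse_density_mul (x : A) :
    (density h tr)⁻¹ʳ * x = S (S x) * (density h tr)⁻¹ʳ := by
  rw [Ring.inverse_mul_eq_iff_eq_mul _ _ _ F.isUnit_density, ← mul_assoc, ← F.mul_density,
    Ring.mul_inverse_cancel_right _ _ F.isUnit_density]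

theorem dualIntegral_mul (a b : A) :
    dualIntegral h tr (a * b) = dualIntegral h tr (b * S (S a)) := by
  rw [dualIntegral_apply, dualIntegral_apply, ← mul_assoc, F.inverse_density_mul, F.comm,
    F.comm _ (b * _), mul_assoc]

theorem dualIntegral_antipode_antipode (a : A) :
    dualIntegral h tr (S (S a)) = dualIntegral h tr a := by
  simpa using (F.dualIntegral_mul a 1).symm

theorem applyFst_dualIntegral_casimir (x : A) :
    applyFst (dualIntegral h tr ∘ₗ LinearMap.mulLeft k x) (casimir k h) = x := by
  have mulLeft_comp : dualIntegral h tr ∘ₗ LinearMap.mulLeft k x =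
      tr ∘ₗ LinearMap.mulLeft k ((density h tr)⁻¹ʳ * x) := by
    ext a; simp [dualIntegral_apply]
  rw [mulLeft_comp, F.applyFst_mulLeft_casimir, Ring.mul_inverse_cancel_left _ _ F.isUnit_density]

theorem applySnd_dualIntegral_casimir (x : A) :
    applySnd (dualIntegral h tr ∘ₗ LinearMap.mulRight k x) (casimir k h) = x := by
  have mulRight_comp : dualIntegral h tr ∘ₗ LinearMap.mulRight k x =
      tr ∘ₗ LinearMap.mulRight k (x * (density h tr)⁻¹ʳ) := by
    ext a; simp [dualIntegral_apply, ← mul_assoc, F.comm _ (density h tr)⁻¹ʳ]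
  rw [mulRight_comp, F.applySnd_mulRight_casimir,
    Ring.inverse_mul_cancel_right _ _ F.isUnit_density]

theorem applyFst_dualIntegral_comul (x : A) :
    applyFst (dualIntegral h tr ∘ₗ LinearMap.mulLeft k x ∘ₗ S) (comul h) = x := by
  simpa only [casimir, applyFst_map, LinearMap.id_apply, LinearMap.comp_assoc] using
    F.applyFst_dualIntegral_casimir x

theorem applySnd_dualIntegral_comul (u : A) :
    applySnd (dualIntegral h tr ∘ₗ LinearMap.mulRight k (S u)) (comul h) = u := by
  apply F.bijective.1
  simpa only [casimir, applySnd_map, LinearMap.comp_id] using F.applySnd_dualIntegral_casimir (S u)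

theorem strong_invariance (x u : A) :
    applySnd (dualIntegral h tr ∘ₗ LinearMap.mulRight k (S u)) (comul x) =
      applyFst (dualIntegral h tr ∘ₗ LinearMap.mulLeft k x ∘ₗ S) (comul u) := by
  conv_lhs => rw [← F.applyFst_dualIntegral_comul x]
  rw [applySnd_comul_applyFst, F.applySnd_dualIntegral_comul]

theorem counit_eq_dualIntegral_mul {y : A} (hy : y ∈ baseR k A) :
    counit (R := k) y = dualIntegral h tr (y * h) := by
  have antipode_haar := F.haar.antipode_eq F.bijective.2
  have applyFst_comul : applyFst (dualIntegral h tr ∘ₗ S) (comul (y * h)) = y := by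
    simpa [comul_baseR_mul hy, applyFst_one_tmul_mul] using
      congrArg (y * ·) (F.applyFst_dualIntegral_comul 1)
  calc counit (R := k) y = dualIntegral h tr (S (y * h)) := by
        conv_lhs => rw [← applyFst_comul]
        rw [apply_applyFst, ← apply_applySnd, applySnd_counit_comul]; rfl
    _ = dualIntegral h tr (h * S (S y)) := by
        rw [antipode_mul_rev, antipode_haar, F.haar.right_integral,
          ← antipode_of_mem_baseL (antipode_mem_baseL hy)]
    _ = dualIntegral h tr (y * h) := (F.dualIntegral_mul y h).symm

end IsTraceFrame

/-! ### The Haar functional -/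

theorem dualMul_apply (φ ψ : Module.Dual k A) (x : A) :
    dualMul φ ψ x = dualTensor φ ψ (comul x) := rfl

theorem dualPiL_apply (φ : Module.Dual k A) (x : A) : dualPiL φ x = φ (piL k x) :=
  (apply_applyFst _ φ _).symm

theorem dualPiR_apply (φ : Module.Dual k A) (x : A) : dualPiR φ x = φ (piR k x) :=
  (apply_applySnd _ φ _).symm

theorem dualMul_counit (φ : Module.Dual k A) : dualMul φ counit = φ := by
  ext x
  rw [dualMul_apply, ← apply_applySnd, applySnd_counit_comul]

theorem counit_dualMul (φ : Module.Dual k A) : dualMul counit φ = φ := by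
  ext x
  rw [dualMul_apply, ← apply_applyFst, applyFst_counit_comul]

theorem dualMul_eq_dualPiL_mul {η : Module.Dual k A} (h : ∀ x, applySnd η (comul x) ∈ baseL k A)
    (φ : Module.Dual k A) : dualMul φ η = dualMul (dualPiL φ) η := by
  ext x
  rw [dualMul_apply, dualMul_apply, ← apply_applySnd, ← apply_applySnd, dualPiL_apply,
    piL_of_mem (h x)]

theorem dualMul_eq_mul_dualPiR {η : Module.Dual k A} (h : ∀ x, applyFst η (comul x) ∈ baseR k A)
    (φ : Module.Dual k A) : dualMul η φ = dualMul η (dualPiR φ) := by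
  ext x
  rw [dualMul_apply, dualMul_apply, ← apply_applyFst, ← apply_applyFst, dualPiR_apply,
    piR_of_mem (h x)]

theorem leftIntegral_eq_rightIntegral {η η' : Module.Dual k A}
    (hη : ∀ φ : Module.Dual k A, dualMul φ η = dualMul (dualPiL φ) η) (hη_norm : dualPiR η = counit)
    (hη' : ∀ φ : Module.Dual k A, dualMul η' φ = dualMul η' (dualPiR φ))
    (hη'_norm : dualPiL η' = counit) : η = η' := by
  calc η = dualMul η' η := by rw [hη, hη'_norm, counit_dualMul]
    _ = η' := by rw [hη', hη_norm, dualMul_counit]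

theorem IsHaarFunctional.eq {η η' : Module.Dual k A} (h : IsHaarFunctional η)
    (h' : IsHaarFunctional η') : η = η' :=
  leftIntegral_eq_rightIntegral h.left_integral h.right_normalized h'.right_integral
    h'.left_normalized

theorem dualMul_comp_antipode_eq {η : Module.Dual k A} (hS : Function.Injective S)
    (h : ∀ x, applySnd η (comul x) ∈ baseL k A) (φ : Module.Dual k A) :
    dualMul (η ∘ₗ S) φ = dualMul (η ∘ₗ S) (dualPiR φ) :=
  dualMul_eq_mul_dualPiR (fun x => mem_baseR_of_antipode_mem hS
    (applySnd_comul_antipode (k := k) η x ▸ h (S x))) φ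

theorem dualPiR_eq_counit {η : Module.Dual k A} (h : ∀ y ∈ baseR k A, η y = counit (R := k) y) :
    dualPiR η = counit := by
  ext x
  rw [dualPiR_apply, h _ (piR_mem x), counit_piR]

theorem dualPiL_comp_antipode_eq_counit {η : Module.Dual k A}
    (h : ∀ y ∈ baseR k A, η y = counit (R := k) y) : dualPiL (η ∘ₗ S) = counit := by
  ext x
  rw [dualPiL_apply, LinearMap.comp_apply, h _ (antipode_mem_baseR (piL_mem x)),
    counit_antipode_of_mem_baseL (piL_mem x), counit_piL]

/-- The functional `λ(· z)`, where `λ = dualIntegral h tr`. It is the Haar functional if `z` is the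
density of the counit, see `IsCounitDensity.isHaarFunctional`. -/
def haarFunctional (h : A) (tr : Module.Dual k A) (z : A) : Module.Dual k A :=
  dualIntegral h tr ∘ₗ LinearMap.mulRight k z

theorem haarFunctional_apply (h : A) (tr : Module.Dual k A) (z x : A) :
    haarFunctional h tr z x = dualIntegral h tr (x * z) := rfl

/-- `z ∈ A^R` is the density of the restriction of the counit to `A^R` with respect to the
functional `λ = dualIntegral h tr`, and `λ` is nondegenerate on `A^R`. -/
structure IsCounitDensity (h : A) (tr : Module.Dual k A) (z : A) : Prop extends
    IsTraceFrame h tr where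
  mem_baseR : z ∈ baseR k A
  apply_mul : ∀ y ∈ baseR k A, dualIntegral h tr (y * z) = counit (R := k) y
  nondegenerate_baseR :
    ∀ x ∈ baseR k A, (∀ y ∈ baseR k A, dualIntegral h tr (y * x) = 0) → x = 0

namespace IsCounitDensity

variable {h : A} {tr : Module.Dual k A} {z : A} (D : IsCounitDensity h tr z)
include D

theorem haarFunctional_baseR {y : A} (hy : y ∈ baseR k A) :
    haarFunctional h tr z y = counit (R := k) y := D.apply_mul y hy

theorem applyFst_haarFunctional_comul_one :
    applyFst (haarFunctional h tr z) (comul 1) = 1 := by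
  rw [← piL_of_mem (applyFst_comul_one_mem (k := k) (haarFunctional h tr z))]
  refine (piL_congr fun a => ?_).trans (piL_of_mem (one_mem _))
  rw [← apply_piR, D.haarFunctional_baseR (piR_mem a), counit_piR, mul_one]

section FiniteDimensional

variable [FiniteDimensional k A]

theorem strong_invariance (x u : A) :
    applySnd (haarFunctional h tr z ∘ₗ LinearMap.mulRight k (S u)) (comul x) =
      applyFst (haarFunctional h tr z ∘ₗ LinearMap.mulLeft k x ∘ₗ S) (comul u) := by
  obtain ⟨w, hw, rfl⟩ := exists_antipode_eq D.bijective.2 D.mem_baseR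
  have invariance := D.toIsTraceFrame.strong_invariance x (w * u)
  rw [comul_baseL_mul hw, applyFst_tmul_one_mul] at invariance
  convert invariance using 2
  · congr 1; ext a; simp [haarFunctional_apply, antipode_mul_rev, mul_assoc]
  · congr 1; ext a; simp [haarFunctional_apply, antipode_mul_rev, mul_assoc]

theorem applySnd_haarFunctional_mem (x : A) :
    applySnd (haarFunctional h tr z) (comul x) ∈ baseL k A := by
  have invariance := D.strong_invariance x 1
  rw [antipode_one, LinearMap.mulRight_one, LinearMap.comp_id] at invariance
  exact invariance ▸ applyFst_comul_one_mem _

theorem haarFunctional_comp_antipode : haarFunctional h tr z ∘ₗ S = haarFunctional h tr z :=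
  (leftIntegral_eq_rightIntegral (dualMul_eq_dualPiL_mul D.applySnd_haarFunctional_mem)
    (dualPiR_eq_counit fun _ => D.haarFunctional_baseR)
    (dualMul_comp_antipode_eq D.bijective.1 D.applySnd_haarFunctional_mem)
    (dualPiL_comp_antipode_eq_counit fun _ => D.haarFunctional_baseR)).symm

theorem haarFunctional_antipode (x : A) :
    haarFunctional h tr z (S x) = haarFunctional h tr z x :=
  LinearMap.congr_fun D.haarFunctional_comp_antipode x

theorem isHaarFunctional : IsHaarFunctional (haarFunctional h tr z) where
  left_integral := dualMul_eq_dualPiL_mul D.applySnd_haarFunctional_mem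
  right_integral := by
    simpa only [D.haarFunctional_comp_antipode] using
      dualMul_comp_antipode_eq D.bijective.1 D.applySnd_haarFunctional_mem
  left_normalized := by
    simpa only [D.haarFunctional_comp_antipode] using
      dualPiL_comp_antipode_eq_counit fun _ => D.haarFunctional_baseR
  right_normalized := dualPiR_eq_counit fun _ => D.haarFunctional_baseR

theorem antipode_antipode_eq : S (S z) = z := by
  rw [← sub_eq_zero]
  have antipode_antipode_mem := antipode_mem_baseR (antipode_mem_baseL D.mem_baseR)
  refine D.nondegenerate_baseR _ (sub_mem antipode_antipode_mem D.mem_baseR) fun y hy => ?_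
  obtain ⟨w, hw, rfl⟩ := exists_antipode_eq D.bijective.2 hy
  obtain ⟨y, rfl⟩ := D.bijective.2 w
  have y_mem : y ∈ baseR k A := mem_baseR_of_antipode_mem D.bijective.1 hw
  rw [mul_sub, map_sub, D.apply_mul _ hy, ← antipode_mul_rev, ← antipode_mul_rev,
    D.dualIntegral_antipode_antipode, D.apply_mul _ y_mem, counit_antipode_of_mem_baseL hw,
    counit_antipode_of_mem_baseR y_mem, sub_self]

theorem hitRight_eq : hitRight h (haarFunctional h tr z) = z := by
  have haarFunctional_eq : haarFunctional h tr z =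
      tr ∘ₗ LinearMap.mulLeft k (z * (density h tr)⁻¹ʳ) := by
    ext a
    rw [haarFunctional_apply, dualIntegral_apply, ← mul_assoc, D.comm, ← mul_assoc]; rfl
  have commute_density : z * density h tr = density h tr * z := by
    rw [D.mul_density, D.antipode_antipode_eq]
  calc hitRight h (haarFunctional h tr z)
      = applyFst (haarFunctional h tr z) (casimir k h) := by
        rw [casimir, applyFst_map, D.haarFunctional_comp_antipode]; rfl
    _ = density h tr * (z * (density h tr)⁻¹ʳ) := by
        rw [haarFunctional_eq, D.applyFst_mulLeft_casimir]
    _ = z := by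
        rw [← mul_assoc, ← commute_density, Ring.mul_inverse_cancel_right _ _ D.isUnit_density]

/-! ### The square of the antipode and the trace property -/

theorem applyFst_mulRight_comul (u v : A) :
    applyFst (haarFunctional h tr z ∘ₗ LinearMap.mulRight k v) (comul u) =
      S (applyFst (haarFunctional h tr z ∘ₗ LinearMap.mulLeft k u) (comul v)) := by
  have mulRight_comp_antipode : (haarFunctional h tr z ∘ₗ LinearMap.mulRight k (S u)) ∘ₗ S =
      haarFunctional h tr z ∘ₗ LinearMap.mulLeft k u := by
    ext a
    simp [← antipode_mul_rev, D.haarFunctional_antipode]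
  have mulLeft_comp_antipode : haarFunctional h tr z ∘ₗ LinearMap.mulLeft k (S v) ∘ₗ S =
      haarFunctional h tr z ∘ₗ LinearMap.mulRight k v := by
    ext a
    simp [← antipode_mul_rev, D.haarFunctional_antipode]
  have invariance := D.strong_invariance (S v) u
  rw [applySnd_comul_antipode, mulRight_comp_antipode, mulLeft_comp_antipode] at invariance
  exact invariance.symm

theorem exists_counit_eq_haarFunctional_mulRight (hz : IsUnit z) :
    ∃ v, haarFunctional h tr z ∘ₗ LinearMap.mulRight k v = counit := by
  obtain ⟨y, hy⟩ := exists_eq_comp_mulRight D.nondegenerate (counit (R := k))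
  refine ⟨y * density h tr * z⁻¹ʳ, LinearMap.ext fun a => ?_⟩
  calc dualIntegral h tr (a * (y * density h tr * z⁻¹ʳ) * z)
      = dualIntegral h tr (a * y * density h tr) := by
        simp only [mul_assoc, Ring.inverse_mul_cancel _ hz, mul_one]
    _ = tr (a * y) := by
        rw [dualIntegral_apply, D.comm, Ring.mul_inverse_cancel_right _ _ D.isUnit_density]
    _ = counit a := by rw [hy]; rfl

theorem antipode_antipode_of_haarFunctional_comm (hz : IsUnit z)
    (ht : ∀ x y, haarFunctional h tr z (x * y) = haarFunctional h tr z (y * x)) (x : A) :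
    S (S x) = x := by
  have mulLeft_eq_mulRight (v : A) : haarFunctional h tr z ∘ₗ LinearMap.mulLeft k v =
      haarFunctional h tr z ∘ₗ LinearMap.mulRight k v := LinearMap.ext fun a => ht v a
  have swap (u v : A) := D.applyFst_mulRight_comul u v
  simp only [mulLeft_eq_mulRight] at swap
  obtain ⟨v, hv⟩ := D.exists_counit_eq_haarFunctional_mulRight hz
  have swap_swap := (swap x v).trans (congrArg _ (swap v x))
  rw [hv, applyFst_counit_comul] at swap_swap
  exact swap_swap.symm

end FiniteDimensional

end IsCounitDensity

theorem trace_piR_eq_trace_piLBar {tr : Module.Dual k A} (htr : ∀ x y, tr (x * y) = tr (y * x))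
    (hSS : ∀ x : A, S (S x) = x) (a : A) : tr (piR k a) = tr (piLBar k a) := by
  have piLBar_eq : piLBar k a = S (piL k a) := by
    rw [← hSS (piLBar k a), antipode_of_mem_baseR (piLBar_mem a), piL_piLBar]
  rw [piLBar_eq, piR_eq_sum a (ℛ k a), piL_eq_sum a (ℛ k a), map_sum, map_sum, map_sum]
  refine Finset.sum_congr rfl fun i _ => ?_
  rw [htr, antipode_mul_rev, hSS]

theorem commute_applyFst_trace_comul_one {tr : Module.Dual k A}
    (htr : ∀ x y, tr (x * y) = tr (y * x)) (hSS : ∀ x : A, S (S x) = x) (a : A) :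
    Commute a (applyFst tr (comul 1)) := by
  calc a * applyFst tr (comul 1) = applyFst (tr ∘ₗ piRHom k A) (comul a) := by
        rw [← applyFst_one_tmul_mul, ← map_piR_id_comul, applyFst_map, LinearMap.id_apply]
    _ = applyFst tr (comul 1) * a := applyFst_comp_piLBar_comul
        (fun a => by rw [LinearMap.comp_apply, piRHom_apply, trace_piR_eq_trace_piLBar htr hSS]) a

namespace IsCounitDensity

variable {h : A} {tr : Module.Dual k A} {z : A} (D : IsCounitDensity h tr z)
include D

theorem commute_of_antipode_antipode (hSS : ∀ x : A, S (S x) = x)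
    (hη : haarFunctional h tr z = tr ∘ₗ LinearMap.mulRight k z) (a : A) : Commute a z := by
  have central := commute_applyFst_trace_comul_one D.comm hSS
  have mul_antipode : applyFst tr (comul 1) * S z = 1 := by
    rw [← applyFst_mul_one_tmul, ← comul_one_mul_tmul_one D.mem_baseR, applyFst_mul_tmul_one, ← hη,
      D.applyFst_haarFunctional_comul_one]
  have antipode_mul : S z * applyFst tr (comul 1) = 1 := by rw [(central _).eq, mul_antipode]
  have antipode_central : Commute (S a) (S z) :=
    (central (S a)).units_inv_right (u := ⟨_, _, mul_antipode, antipode_mul⟩)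
  exact D.bijective.1 (by rw [antipode_mul_rev, antipode_mul_rev, antipode_central.eq])

theorem haarFunctional_comm (hSS : ∀ x : A, S (S x) = x) (hd : density h tr = 1) (x y : A) :
    haarFunctional h tr z (x * y) = haarFunctional h tr z (y * x) := by
  have haarFunctional_eq : haarFunctional h tr z = tr ∘ₗ LinearMap.mulRight k z := by
    ext a; simp [haarFunctional_apply, dualIntegral_apply, hd]
  simp only [haarFunctional_eq, LinearMap.comp_apply, LinearMap.mulRight_apply]
  rw [mul_assoc, D.comm, mul_assoc, ← (D.commute_of_antipode_antipode hSS haarFunctional_eq x).eq,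
    mul_assoc]

end IsCounitDensity

/-! ### The regular trace of a weak Hopf algebra -/

namespace IsTraceFrame

variable {h : A} {tr : Module.Dual k A} (F : IsTraceFrame h tr) [FiniteDimensional k A]
include F

theorem sum_dualIntegral_mul_antipode {ι : Type*} (r : Coalgebra.Repr k h ι) (x : A) :
    ∑ i ∈ r.index, dualIntegral h tr (x * S (r.left i)) • r.right i = x := by
  conv_rhs => rw [← F.applyFst_dualIntegral_comul x, ← r.eq]
  simp

theorem sum_dualIntegral_mul {ι : Type*} (r : Coalgebra.Repr k h ι) (x : A) :
    ∑ i ∈ r.index, dualIntegral h tr (r.right i * x) • S (r.left i) = x := by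
  conv_rhs => rw [← F.applySnd_dualIntegral_casimir x, casimir, ← r.eq]
  simp

theorem trace_mulLeft_eq_trace_mulRight (a : A) :
    LinearMap.trace k A (LinearMap.mulLeft k a) = LinearMap.trace k A (LinearMap.mulRight k a) := by
  let r := ℛ k h
  have mulLeft_eq : LinearMap.mulLeft k a = ∑ i ∈ r.index, LinearMap.smulRight
      (dualIntegral h tr ∘ₗ LinearMap.mulLeft k (r.right i)) (a * S (r.left i)) := by
    ext x
    conv_lhs => rw [← F.sum_dualIntegral_mul r x]
    simp
  have mulRight_eq : LinearMap.mulRight k a = ∑ i ∈ r.index, LinearMap.smulRight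
      (dualIntegral h tr ∘ₗ LinearMap.mulRight k (a * S (r.left i))) (r.right i) := by
    ext x
    conv_lhs => rw [LinearMap.mulRight_apply, ← F.sum_dualIntegral_mul_antipode r (x * a)]
    simp [mul_assoc]
  rw [mulLeft_eq, mulRight_eq]
  simp [mul_assoc]

end IsTraceFrame

section RegularTrace

variable {h : A} (F : IsTraceFrame h (regularTrace k A)) [FiniteDimensional k A]
include F

theorem regularTrace_antipode (a : A) : regularTrace k A (S a) = regularTrace k A a := by
  let e := LinearEquiv.ofBijective S F.bijective
  have conj_mulRight : e.conj (LinearMap.mulRight k a) = LinearMap.mulLeft k (S a) := by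
    ext x
    obtain ⟨y, rfl⟩ := e.surjective x
    rw [LinearEquiv.conj_apply_apply, LinearEquiv.symm_apply_apply]
    exact antipode_mul_rev y a
  calc regularTrace k A (S a) = LinearMap.trace k A (LinearMap.mulRight k a) := by
        rw [← LinearMap.trace_conj' _ e, conj_mulRight]; rfl
    _ = regularTrace k A a := (F.trace_mulLeft_eq_trace_mulRight a).symm

theorem density_eq_mul'_comm_casimir : density h (regularTrace k A) =
    LinearMap.mul' k A (TensorProduct.comm k A A (casimir k h)) := by
  let r := ℛ k h
  set d := density h (regularTrace k A)
  set q := LinearMap.mul' k A (TensorProduct.comm k A A (casimir k h)) with q_def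
  have q_eq : q = ∑ i ∈ r.index, r.right i * S (r.left i) := by
    rw [q_def, casimir, ← r.eq]
    simp
  have mulLeft_eq (a : A) : LinearMap.mulLeft k a = ∑ i ∈ r.index, LinearMap.smulRight
      (dualIntegral h (regularTrace k A) ∘ₗ LinearMap.mulRight k (S (r.left i)))
      (a * r.right i) := by
    ext x
    conv_lhs => rw [← F.sum_dualIntegral_mul_antipode r x]
    simp
  have trace_eq (a : A) : regularTrace k A a = dualIntegral h (regularTrace k A) (a * q) := by
    change LinearMap.trace k A (LinearMap.mulLeft k a) = _
    rw [mulLeft_eq, q_eq]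
    simp [Finset.mul_sum, mul_assoc]
  have one_eq : 1 - q * d⁻¹ʳ = 0 := F.nondegenerate _ fun a => by
    rw [mul_sub, mul_one, map_sub, trace_eq a, dualIntegral_apply, F.comm, mul_assoc, sub_self]
  calc d = q * d⁻¹ʳ * d := by rw [← sub_eq_zero.1 one_eq, one_mul]
    _ = q := Ring.inverse_mul_cancel_right _ _ F.isUnit_density

theorem regularTrace_density : regularTrace k A (density h (regularTrace k A)) =
    regularTrace k A 1 := by
  have trace_mul'_comm (s : A ⊗[k] A) :
      regularTrace k A (LinearMap.mul' k A (TensorProduct.comm k A A s)) =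
        regularTrace k A (LinearMap.mul' k A s) := by
    induction s <;> simp_all [F.comm]
  rw [density_eq_mul'_comm_casimir F, trace_mul'_comm, F.haar.mul'_casimir]

theorem density_eq_applyFst_comul :
    density h (regularTrace k A) = applyFst (regularTrace k A) (comul h) := by
  have trace_comp_antipode : regularTrace k A ∘ₗ S = regularTrace k A :=
    LinearMap.ext (regularTrace_antipode F)
  rw [← mul_one (density h _), ← F.applyFst_mulLeft_casimir 1, LinearMap.mulLeft_one,
    LinearMap.comp_id, casimir, applyFst_map, trace_comp_antipode, LinearMap.id_apply]

end RegularTrace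

end WeakHopfAlgebra

/-! ### C⋆-weak Hopf algebras -/

namespace CStarWeakHopfAlgebra

open WeakHopfAlgebra
open scoped ComplexOrder

local infixl:70 " ⋆ " => convMul

section Star

variable {A : Type*} [CStarAlgebra A]

/-- The adjoint `φ⋆(x) = conj (φ (x⋆))` of a linear functional. -/
def dualStar (φ : Module.Dual ℂ A) : Module.Dual ℂ A where
  toFun x := star (φ (star x))
  map_add' x y := by simp
  map_smul' c x := by simp

theorem dualStar_apply (φ : Module.Dual ℂ A) (x : A) : dualStar φ x = star (φ (star x)) := rfl

theorem star_applyFst (φ : Module.Dual ℂ A) (t : A ⊗[ℂ] A) :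
    star (applyFst φ t) = applyFst (dualStar φ) (star t) := by
  induction t <;> simp_all [dualStar_apply]

theorem star_applySnd (φ : Module.Dual ℂ A) (t : A ⊗[ℂ] A) :
    star (applySnd φ t) = applySnd (dualStar φ) (star t) := by
  induction t <;> simp_all [dualStar_apply]

variable [CStarWeakHopfAlgebra A]

local notation "S" => antipode (k := ℂ) (A := A)

theorem star_comul_one : star (comul (R := ℂ) (1 : A)) = comul 1 := by
  rw [← comul_star, star_one]

theorem dualStar_counit : dualStar (counit (R := ℂ) (A := A)) = counit := by
  have left_counit (x : A) : applyFst (dualStar (counit (R := ℂ))) (comul x) = x := by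
    rw [← star_star (comul x), ← comul_star, ← star_applyFst, applyFst_counit_comul, star_star]
  ext x
  rw [← congrArg (counit (R := ℂ)) (left_counit x), apply_applyFst, ← apply_applySnd,
    applySnd_counit_comul]

theorem counit_star (x : A) : counit (R := ℂ) (star x) = star (counit (R := ℂ) x) := by
  rw [← dualStar_counit, dualStar_apply, star_star, dualStar_counit]

theorem star_mem_baseR {y : A} (hy : y ∈ baseR ℂ A) : star y ∈ baseR ℂ A := by
  obtain ⟨right_eq, left_eq⟩ := mem_baseR.1 hy
  rw [mem_baseR, comul_star]
  constructor
  · rw [left_eq, star_mul, star_comul_one, star_tmul, star_one]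
  · rw [right_eq, star_mul, star_comul_one, star_tmul, star_one]

theorem star_piL_star (x : A) : star (piL ℂ (star x)) = piRBar ℂ x := by
  rw [piL, star_applyFst, star_comul_one, piRBar]
  congr 2
  ext a
  simp [dualStar_apply, ← star_mul, counit_star]

theorem star_piR_star (x : A) : star (piR ℂ (star x)) = piLBar ℂ x := by
  rw [piR, star_applySnd, star_comul_one, piLBar]
  congr 2
  ext a
  simp [dualStar_apply, ← star_mul, counit_star]

variable (A) in
/-- The linear map `x ↦ S(x⋆)⋆`, which is the inverse of the antipode. -/
def antipodeStar : A →ₗ[ℂ] A where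
  toFun x := star (S (star x))
  map_add' x y := by simp
  map_smul' c x := by simp

theorem antipodeStar_apply (x : A) : antipodeStar A x = star (S (star x)) := rfl

theorem star_convMul_star (f g : A →ₗ[ℂ] A) (x : A) {ι : Type*} (r : Coalgebra.Repr ℂ x ι) :
    star ((f ⋆ g) (star x)) =
      ∑ i ∈ r.index, star (g (star (r.right i))) * star (f (star (r.left i))) := by
  rw [convMul_apply, comul_star, ← r.eq]
  simp [star_sum]

theorem antipode_convMul_antipode_comp_antipodeStar :
    S ⋆ (S ∘ₗ antipodeStar A) = piRHom ℂ A := by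
  ext x
  have piRBar_eq : piRBar ℂ x = ∑ i ∈ (ℛ ℂ x).index,
      antipodeStar A ((ℛ ℂ x).right i) * (ℛ ℂ x).left i := by
    rw [← star_piL_star, ← piLHom_apply, piLHom, star_convMul_star _ _ x (ℛ ℂ x)]
    simp [antipodeStar_apply]
  rw [piRHom_apply, ← piR_piRBar, ← antipode_of_mem_baseL (piRBar_mem x), piRBar_eq,
    convMul_repr _ _ (ℛ ℂ x), map_sum]
  exact Finset.sum_congr rfl fun i _ => (antipode_mul_rev _ _).symm

theorem piLHom_convMul_antipode_comp_antipodeStar :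
    piLHom ℂ A ⋆ (S ∘ₗ antipodeStar A) = S ∘ₗ antipodeStar A := by
  ext x
  have antipodeStar_eq : antipodeStar A x = ∑ i ∈ (ℛ ℂ x).index,
      antipodeStar A ((ℛ ℂ x).right i) * piLBar ℂ ((ℛ ℂ x).left i) := by
    rw [antipodeStar_apply, ← convMul_piRHom_antipode, star_convMul_star _ _ x (ℛ ℂ x)]
    simp only [piRHom_apply, star_piR_star, antipodeStar_apply]
  rw [LinearMap.comp_apply, antipodeStar_eq, convMul_repr _ _ (ℛ ℂ x), map_sum]
  refine Finset.sum_congr rfl fun i _ => ?_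
  rw [antipode_mul_rev, antipode_of_mem_baseR (piLBar_mem _), piL_piLBar, piLHom_apply]
  rfl

theorem antipode_comp_antipodeStar : S ∘ₗ antipodeStar A = LinearMap.id := by
  rw [← piLHom_convMul_antipode_comp_antipodeStar, piLHom, convMul_assoc,
    antipode_convMul_antipode_comp_antipodeStar, piRHom, ← convMul_assoc, ← piLHom,
    convMul_piLHom_id]

theorem antipode_star_antipode_star (x : A) : S (star (S (star x))) = x :=
  LinearMap.congr_fun antipode_comp_antipodeStar x

theorem antipode_bijective : Function.Bijective S := by
  refine ⟨fun x y h => star_injective ?_, fun x => ⟨_, antipode_star_antipode_star x⟩⟩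
  rw [← antipode_star_antipode_star (star x), ← antipode_star_antipode_star (star y), star_star,
    star_star, h]

end Star

variable {A : Type*} [CStarAlgebra A] [CStarWeakHopfAlgebra A] [FiniteDimensional ℂ A]
  [PartialOrder A] [StarOrderedRing A]

local notation "S" => antipode (k := ℂ) (A := A)

/-! ### Existence of the Haar integral -/

variable (A) in
theorem exists_isHaarIntegral_isStarProjection :
    ∃ h : A, IsHaarIntegral ℂ h ∧ IsStarProjection h := by
  obtain ⟨q, hq, mem_iff⟩ := exists_isStarProjection_forall_mem_iff (counitLeftIdeal ℂ A)
  have mul_compl_eq_zero {x : A} (hx : ∀ a, counit (R := ℂ) (a * x) = 0) : x * (1 - q) = 0 := by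
    rw [mul_sub, mul_one, (mem_iff x).1 hx, sub_self]
  have compl_mul_eq_zero {x : A} (hx : ∀ a, counit (R := ℂ) (x * a) = 0) : (1 - q) * x = 0 := by
    have star_x : star x * (1 - q) = 0 := mul_compl_eq_zero fun a => by
      rw [← star_star a, ← star_mul, counit_star, hx, star_zero]
    rw [← star_star ((1 - q) * x), star_mul, hq.one_sub.isSelfAdjoint.star_eq, star_x, star_zero]
  have counit_mul_q (a : A) : counit (R := ℂ) (a * q) = 0 :=
    (mem_iff q).2 hq.isIdempotentElem a
  have counit_q_mul (a : A) : counit (R := ℂ) (q * a) = 0 := by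
    rw [← star_star (q * a), counit_star, star_mul, hq.isSelfAdjoint.star_eq, counit_mul_q,
      star_zero]
  refine ⟨1 - q, ⟨fun x => ?_, fun x => ?_, ?_, ?_⟩, hq.one_sub⟩
  · rw [← sub_eq_zero, ← sub_mul]
    exact mul_compl_eq_zero fun a => by rw [mul_sub, map_sub, counit_mul_piL, sub_self]
  · rw [← sub_eq_zero, ← mul_sub]
    exact compl_mul_eq_zero fun a => by rw [sub_mul, map_sub, counit_piR_mul, sub_self]
  · refine (piL_congr fun a => ?_).trans (piL_of_mem (one_mem _))
    rw [mul_sub, map_sub, counit_mul_q, sub_zero]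
  · refine (piR_congr fun a => ?_).trans (piR_of_mem (one_mem _))
    rw [sub_mul, map_sub, counit_q_mul, sub_zero]

section Positivity

variable {h : A}

local notation "Λ" => dualIntegral h (regularTrace ℂ A)

section HaarIntegral

variable (hh : IsHaarIntegral ℂ h)
include hh

theorem isStarProjection_of_isHaarIntegral : IsStarProjection h := by
  obtain ⟨h', hh', projection⟩ := exists_isHaarIntegral_isStarProjection A
  rwa [hh.eq hh']

theorem isTraceFrame_regularTrace : IsTraceFrame h (regularTrace ℂ A) where
  haar := hh
  bijective := antipode_bijective
  comm := regularTrace_mul_comm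
  nondegenerate := regularTrace_nondegenerate

theorem isStrictlyPositive_density : IsStrictlyPositive (density h (regularTrace ℂ A)) := by
  refine (isTraceFrame_regularTrace hh).isUnit_density.isStrictlyPositive ?_
  have projection := isStarProjection_of_isHaarIntegral hh
  have comul_eq : comul (R := ℂ) h = star (comul h) * comul h := by
    rw [← comul_star, projection.isSelfAdjoint.star_eq, ← comul_mul,
      projection.isIdempotentElem.eq]
  rw [density_eq_applyFst_comul (isTraceFrame_regularTrace hh), comul_eq]
  exact applyFst_regularTrace_star_mul_self_nonneg _

/-! ### Positivity of the counit density -/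

theorem dualIntegral_star_mul_self_nonneg (a : A) : 0 ≤ Λ (star a * a) := by
  rw [(isTraceFrame_regularTrace hh).dualIntegral_mul_eq_trace]
  exact regularTrace_mul_mul_star_nonneg (isStrictlyPositive_density hh).ringInverse.nonneg a

theorem eq_zero_of_dualIntegral_star_mul_self {a : A} (ha : Λ (star a * a) = 0) : a = 0 :=
  eq_zero_of_regularTrace_mul_mul_star (isStrictlyPositive_density hh).ringInverse
    (by rwa [← (isTraceFrame_regularTrace hh).dualIntegral_mul_eq_trace])

theorem dualIntegral_star (x : A) : Λ (star x) = star (Λ x) := by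
  refine map_star (PositiveLinearMap.mk₀ Λ fun a ha => ?_) x
  obtain ⟨b, rfl⟩ := CStarAlgebra.nonneg_iff_eq_star_mul_self.1 ha
  exact dualIntegral_star_mul_self_nonneg hh b

theorem exists_isCounitDensity : ∃ z, IsCounitDensity h (regularTrace ℂ A) z := by
  have nondegenerate_baseR (a : A) (ha : a ∈ baseR ℂ A)
      (h_zero : ∀ y ∈ baseR ℂ A, Λ (y * a) = 0) : a = 0 :=
    eq_zero_of_dualIntegral_star_mul_self hh (h_zero _ (star_mem_baseR ha))
  let incl : baseR ℂ A →ₗ[ℂ] A := (baseR ℂ A).val.toLinearMap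
  obtain ⟨z, hz⟩ := exists_eq_comp_mulRight (f := Λ ∘ₗ incl)
    (fun a ha => Subtype.ext (nondegenerate_baseR a a.2 fun y hy => ha ⟨y, hy⟩)) (counit ∘ₗ incl)
  exact ⟨z, isTraceFrame_regularTrace hh, z.2, fun y hy => (LinearMap.congr_fun hz ⟨y, hy⟩).symm,
    nondegenerate_baseR⟩

end HaarIntegral

section CounitDensity

variable {z : A} (D : IsCounitDensity h (regularTrace ℂ A) z)
include D

theorem star_counitDensity : star z = z := by
  rw [← sub_eq_zero]
  refine D.nondegenerate_baseR _ (sub_mem (star_mem_baseR D.mem_baseR) D.mem_baseR)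
    fun y hy => ?_
  have apply_mul_star : Λ (y * star z) = counit (R := ℂ) y := by
    rw [← star_star (y * star z), dualIntegral_star D.haar, star_mul, star_star, D.dualIntegral_mul,
      D.antipode_antipode_eq, D.apply_mul _ (star_mem_baseR hy), counit_star, star_star]
  rw [mul_sub, map_sub, apply_mul_star, D.apply_mul y hy, sub_self]

theorem dualIntegral_star_mul_mul {y : A} (hy : y ∈ baseR ℂ A) :
    Λ (star y * z * y) = Λ (star (h * y) * (h * y)) := by
  have projection := isStarProjection_of_isHaarIntegral D.haar
  have w_mem : y * S (S (star y)) ∈ baseR ℂ A :=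
    mul_mem hy (antipode_mem_baseR (antipode_mem_baseL (star_mem_baseR hy)))
  have antipode_h : S h = h := D.haar.antipode_eq D.bijective.2
  calc Λ (star y * z * y) = counit (R := ℂ) (y * S (S (star y))) := by
        rw [mul_assoc, D.dualIntegral_mul, mul_assoc, D.dualIntegral_mul z,
          D.antipode_antipode_eq, D.apply_mul _ w_mem]
    _ = Λ (star y * h * y) := by
        rw [mul_assoc, D.dualIntegral_mul (star y), mul_assoc, D.dualIntegral_mul h, antipode_h,
          antipode_h, D.counit_eq_dualIntegral_mul w_mem]
    _ = Λ (star (h * y) * (h * y)) := by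
        rw [star_mul, projection.isSelfAdjoint.star_eq, mul_assoc, mul_assoc, ← mul_assoc h h,
          projection.isIdempotentElem.eq]

theorem eq_zero_of_haarIntegral_mul_eq_zero {y : A} (hy : y ∈ baseR ℂ A) (hhy : h * y = 0) :
    y = 0 := by
  have star_mul_h : star y * h = 0 := by
    rw [← (isStarProjection_of_isHaarIntegral D.haar).isSelfAdjoint.star_eq, ← star_mul, hhy,
      star_zero]
  have antipode_star_y : S (star y) = 0 := by
    rw [antipode_of_mem_baseR (star_mem_baseR hy), ← mul_one (star y), ← D.haar.left_normalized,
      piL_mul_piL, star_mul_h, ← piLHom_apply, map_zero]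
  exact star_eq_zero.1 (antipode_bijective.1 (antipode_star_y.trans (map_zero S).symm))

theorem eq_zero_of_counitDensity_mul_eq_smul {μ : ℝ} (hμ : μ ≤ 0) {y : A} (hy : y ∈ baseR ℂ A)
    (eigenvector : z * y = (μ : ℂ) • y) : y = 0 := by
  have apply_eq : (μ : ℂ) * Λ (star y * y) = Λ (star (h * y) * (h * y)) := by
    rw [← dualIntegral_star_mul_mul D hy, mul_assoc, eigenvector, mul_smul_comm, map_smul,
      smul_eq_mul]
  have nonpos : (μ : ℂ) * Λ (star y * y) ≤ 0 := mul_nonpos_of_nonpos_of_nonneg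
    (by exact_mod_cast hμ) (dualIntegral_star_mul_self_nonneg D.haar y)
  rw [apply_eq] at nonpos
  exact eq_zero_of_haarIntegral_mul_eq_zero D hy <| eq_zero_of_dualIntegral_star_mul_self D.haar <|
    nonpos.antisymm (dualIntegral_star_mul_self_nonneg D.haar _)

theorem exists_mem_baseR_mul_eq_one {μ : ℝ} (hμ : μ ≤ 0) :
    ∃ w ∈ baseR ℂ A, (z - (μ : ℂ) • 1) * w = 1 ∧ w * (z - (μ : ℂ) • 1) = 1 := by
  have isUnit_sub : IsUnit ((⟨z, D.mem_baseR⟩ : baseR ℂ A) - (μ : ℂ) • 1) := by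
    refine isUnit_of_forall_mul_eq_zero ℂ fun y hy => Subtype.ext ?_
    refine eq_zero_of_counitDensity_mul_eq_smul D hμ y.2 ?_
    rw [sub_mul, smul_mul_assoc, one_mul, sub_eq_zero] at hy
    exact congrArg Subtype.val hy
  obtain ⟨u, hu⟩ := isUnit_sub
  exact ⟨u⁻¹.1, u⁻¹.1.2, congrArg Subtype.val (hu ▸ u.mul_inv),
    congrArg Subtype.val (hu ▸ u.inv_mul)⟩

theorem isStrictlyPositive_counitDensity : IsStrictlyPositive z := by
  have selfAdjoint : IsSelfAdjoint z := star_counitDensity D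
  rw [StarOrderedRing.isStrictlyPositive_iff_spectrum_pos (R := ℝ) z]
  intro μ hμ
  by_contra! nonpos
  obtain ⟨w, -, mul_eq, eq_mul⟩ := exists_mem_baseR_mul_eq_one D nonpos
  refine (spectrum.mem_iff.1 hμ) ?_
  have resolvent_eq : algebraMap ℝ A μ - z = -(z - (μ : ℂ) • 1) := by
    rw [Algebra.algebraMap_eq_smul_one, neg_sub, Complex.coe_smul]
  rw [resolvent_eq]
  exact IsUnit.neg ⟨⟨_, w, mul_eq, eq_mul⟩, rfl⟩

theorem counit_inverse_counitDensity :
    counit (R := ℂ) z⁻¹ʳ = regularTrace ℂ A (density h (regularTrace ℂ A))⁻¹ʳ := by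
  obtain ⟨w, w_mem, mul_eq, eq_mul⟩ := exists_mem_baseR_mul_eq_one D le_rfl
  rw [Complex.ofReal_zero, zero_smul, sub_zero] at mul_eq eq_mul
  have inverse_eq : z⁻¹ʳ = w := Ring.inverse_unit ⟨z, w, mul_eq, eq_mul⟩
  rw [inverse_eq, ← D.apply_mul w w_mem, eq_mul, dualIntegral_apply, mul_one]

theorem inverse_grouplikeR_sq :
    (grouplikeR h (haarFunctional h (regularTrace ℂ A) z))⁻¹ʳ ^ 2 = z⁻¹ʳ := by
  rw [grouplikeR, D.hitRight_eq, Ring.inverse_pow,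
    CFC.sq_sqrt z (isStrictlyPositive_counitDensity D).nonneg]

theorem counit_inverse_grouplikeR_sq :
    counit (R := ℂ) ((grouplikeR h (haarFunctional h (regularTrace ℂ A) z))⁻¹ʳ ^ 2) =
      regularTrace ℂ A (density h (regularTrace ℂ A))⁻¹ʳ := by
  rw [inverse_grouplikeR_sq D, counit_inverse_counitDensity D]

end CounitDensity

end Positivity

/-! ### Weak Kac algebras -/

section WeakKac

variable {h : A} (hh : IsHaarIntegral ℂ h)
include hh

theorem density_eq_one_of_antipode_antipode (hSS : ∀ x : A, S (S x) = x) :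
    density h (regularTrace ℂ A) = 1 := by
  rw [density_eq_mul'_comm_casimir (isTraceFrame_regularTrace hh),
    hh.mul'_comm_casimir antipode_bijective.2 hSS]

theorem antipode_antipode_of_density_eq_one (hd : density h (regularTrace ℂ A) = 1) (x : A) :
    S (S x) = x := by
  simpa only [hd, mul_one, one_mul] using ((isTraceFrame_regularTrace hh).mul_density x).symm

theorem antipode_antipode_iff_density_eq_one :
    (∀ x : A, S (S x) = x) ↔ density h (regularTrace ℂ A) = 1 :=
  ⟨density_eq_one_of_antipode_antipode hh, antipode_antipode_of_density_eq_one hh⟩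

theorem density_eq_one_iff : density h (regularTrace ℂ A) = 1 ↔
    regularTrace ℂ A (density h (regularTrace ℂ A))⁻¹ʳ = Module.finrank ℂ A := by
  rw [← regularTrace_one]
  exact ⟨fun hd => by rw [hd, Ring.inverse_one], eq_one_of_regularTrace_eq
    (isStrictlyPositive_density hh) (regularTrace_density (isTraceFrame_regularTrace hh))⟩

end WeakKac

theorem antipode_antipode_iff_haarFunctional_comm {h z : A}
    (D : IsCounitDensity h (regularTrace ℂ A) z) : (∀ x : A, S (S x) = x) ↔
    ∀ x y, haarFunctional h (regularTrace ℂ A) z (x * y) =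
      haarFunctional h (regularTrace ℂ A) z (y * x) :=
  ⟨fun hSS => D.haarFunctional_comm hSS (density_eq_one_of_antipode_antipode D.haar hSS),
    D.antipode_antipode_of_haarFunctional_comm (isStrictlyPositive_counitDensity D).isUnit⟩

end CStarWeakHopfAlgebra

end

open WeakHopfAlgebra CStarWeakHopfAlgebra in
theorem mainTheorem12 (A : Type*) [CStarAlgebra A] [PartialOrder A] [StarOrderedRing A]
    [FiniteDimensional ℂ A] [CStarWeakHopfAlgebra A] :
    (∃! h : A, WeakHopfAlgebra.IsHaarIntegral ℂ h) ∧
    (∃! η : Module.Dual ℂ A, WeakHopfAlgebra.IsHaarFunctional η) ∧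
    ∀ (h : A) (η : Module.Dual ℂ A),
      WeakHopfAlgebra.IsHaarIntegral ℂ h → WeakHopfAlgebra.IsHaarFunctional η →
      IsStrictlyPositive (WeakHopfAlgebra.hitRight h η) ∧
      List.TFAE [
        ∀ x : A, WeakHopfAlgebra.antipode (k := ℂ) (WeakHopfAlgebra.antipode (k := ℂ) x) = x,
        ∀ x y : A, η (x * y) = η (y * x),
        Coalgebra.counit (R := ℂ) (Ring.inverse (grouplikeR h η) ^ 2) =
          (Module.finrank ℂ A : ℂ)] := by
  obtain ⟨h₀, hh₀, -⟩ := exists_isHaarIntegral_isStarProjection A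
  obtain ⟨z₀, D₀⟩ := exists_isCounitDensity hh₀
  refine ⟨⟨h₀, hh₀, fun h hh => hh.eq hh₀⟩,
    ⟨_, D₀.isHaarFunctional, fun η hη => hη.eq D₀.isHaarFunctional⟩, fun h η hh hη => ?_⟩
  obtain ⟨z, D⟩ := exists_isCounitDensity hh
  obtain rfl := hη.eq D.isHaarFunctional
  rw [counit_inverse_grouplikeR_sq D, D.hitRight_eq]
  refine ⟨isStrictlyPositive_counitDensity D, ?_⟩
  tfae_have 1 ↔ 2 := antipode_antipode_iff_haarFunctional_comm D
  tfae_have 1 ↔ 3 := (antipode_antipode_iff_density_eq_one hh).trans (density_eq_one_iff hh)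
  tfae_finish
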